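/- Let $T=(V,E)$ be a free tree on $n\ge 1$ vertices, $V=\{0,\dots,n-1\}$. A linear arrangement of $T$ is a bijection $\pi:V\to\{1,\dots,n\}$; it is planar if there are no edges $st,uv\in E$ with $\pi(s)<\pi(u)<\pi(t)<\pi(v)$. Let $D_\pi(T)=\sum_{uv\in E}|\pi(u)-\pi(v)|$, and let $\mathbb{E}_{\mathrm{pl}}[D]$ be the expected value of $D_\pi(T)$ when $\pi$ is drawn uniformly at random among the planar arrangements of $T$. For an edge $uv$, let the directional subtree size $s_u(v)$ be the number of vertices of the subtree of $v$ when $T$ is rooted at $u$. Consider the following algorithm, whose input is $T$, given by arrays that list the neighbours of each vertex in any order. (1) Compute the set $S=\{(u,v,s_u(v)),(v,u,s_v(u)) : uv\in E\}$ recursively: for every neighbour $w$ of the vertex $0$ call $\mathrm{sizes}(0,w)$, where $\mathrm{sizes}(u,v)$ starts with $s:=1$, adds $\mathrm{sizes}(v,w)$ to $s$ for every neighbour $w\ne u$ of $v$, adds the triples $(u,v,s)$ and $(v,u,n-s)$ to $S$, and returns $s$. (2) Set $L[v]:=0$ for all $v\in V$ and, for each $(u,v,s)\in S$, add $s^2$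 to $L[u]$. (3) Return, as a fraction, $$\frac{(n-1)(3n^2+2n-2)-\sum_{v\in V}(2\deg(v)-1)\,L[v]}{6n}.$$ For every free tree $T$ the algorithm terminates and returns $\mathbb{E}_{\mathrm{pl}}[D]$, and it runs in $O(n)$ time and $O(n)$ space: there is a constant $C$, independent of $n$, of $T$ and of the order of the neighbours, such that on a random access machine with unit-cost operations on integers the computation takes at most $Cn$ units of time, uses at all times at most $Cn$ words of space (input, working arrays, local variables and recursion stack included), and keeps in memory only integers of absolute value at most $Cn^3$, that is, of $O(\log n)$ bits. -/

import Mathlib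

namespace PlanarSum

/-! ## Linear arrangements of a tree and the expected sum of edge lengths -/

/-- A linear arrangement of the vertices `0, …, n - 1`: a bijection from the vertices onto the `n`
positions.  Positions are numbered from `0`; only their order and their differences matter. -/
abbrev Arrangement (n : ℕ) : Type := Equiv.Perm (Fin n)

/-- An arrangement is planar if no two edges `st`, `uv` cross, that is, never
`π s < π u < π t < π v`. -/
def IsPlanar {n : ℕ} (G : SimpleGraph (Fin n)) (π : Arrangement n) : Prop :=
  ∀ s t u v : Fin n, G.Adj s t → G.Adj u v → ¬ (π s < π u ∧ π u < π t ∧ π t < π v)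

/-- The length `|π u - π v|` of the pair `uv` in the arrangement `π`. -/
def edgeLength {n : ℕ} (π : Arrangement n) : Sym2 (Fin n) → ℤ :=
  Sym2.lift ⟨fun u v => |((π u : ℕ) : ℤ) - ((π v : ℕ) : ℤ)|, fun _ _ => abs_sub_comm _ _⟩

open Classical in
/-- The sum `D` of the lengths of all (undirected) edges in the arrangement `π`. -/
noncomputable def sumEdgeLengths {n : ℕ} (G : SimpleGraph (Fin n)) (π : Arrangement n) : ℤ :=
  ∑ e ∈ G.edgeFinset, edgeLength π e

open Classical in
/-- The set of the planar arrangements of `G`. -/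
noncomputable def planarArrangements {n : ℕ} (G : SimpleGraph (Fin n)) :
    Finset (Arrangement n) :=
  Finset.univ.filter (fun π => IsPlanar G π)

/-- The expected value of `D` in a uniformly random planar arrangement of `G`. -/
noncomputable def expectedPlanar {n : ℕ} (G : SimpleGraph (Fin n)) : ℚ :=
  (∑ π ∈ planarArrangements G, (sumEdgeLengths G π : ℚ)) / ((planarArrangements G).card : ℚ)

/-! ## A random access machine with integer words, arrays and recursive procedures -/

/-- The read-only input: for every vertex an array that lists vertices. -/
abbrev AdjLists (n : ℕ) : Type := Fin n → List (Fin n)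

/-- `A` is an adjacency list representation of `G`: the array of `v` lists the neighbours of `v`,
each once, in any order. -/
def AdjLists.Represents {n : ℕ} (A : AdjLists n) (G : SimpleGraph (Fin n)) : Prop :=
  ∀ v : Fin n, (A v).Nodup ∧ ∀ w : Fin n, w ∈ A v ↔ G.Adj v w

/-- The number of words that the input takes. -/
def AdjLists.size {n : ℕ} (A : AdjLists n) : ℕ := n + ∑ v, (A v).length

/-- Reading `l[z]`; it fails if `z` is out of bounds. -/
def readAt (l : List ℤ) (z : ℤ) : Option ℤ := if 0 ≤ z then l[z.toNat]? else none

/-- The effect of `l[z] := w`; it fails if `z` is out of bounds. -/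
def writeAt (l : List ℤ) (z w : ℤ) : Option (List ℤ) :=
  if 0 ≤ z ∧ z.toNat < l.length then some (l.set z.toNat w) else none

/-- The length of the input array of the vertex `z`. -/
def degAt {n : ℕ} (A : AdjLists n) (z : ℤ) : Option ℤ :=
  if h : 0 ≤ z ∧ z.toNat < n then some ((A ⟨z.toNat, h.2⟩).length : ℤ) else none

/-- The entry number `i` (from `0`) of the input array of the vertex `z`. -/
def nbrAt {n : ℕ} (A : AdjLists n) (z i : ℤ) : Option ℤ :=
  if h : 0 ≤ z ∧ z.toNat < n then
    readAt ((A ⟨z.toNat, h.2⟩).map (fun w => ((w : ℕ) : ℤ))) i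
  else none

/-- Expressions. -/
inductive Exp : Type
  /-- an integer constant -/
  | lit (z : ℤ)
  /-- a local variable -/
  | var (x : ℕ)
  /-- the number of vertices of the input -/
  | size
  /-- the degree of a vertex -/
  | deg (v : Exp)
  /-- an entry of the adjacency array of a vertex -/
  | nbr (v i : Exp)
  /-- an entry of the working array `a` -/
  | get (a : ℕ) (i : Exp)
  | add (e f : Exp)
  | sub (e f : Exp)
  | mul (e f : Exp)

/-- The value of an expression, for the input `A`, the local variables `loc` and the working
arrays `heap`. -/
def Exp.eval {n : ℕ} (A : AdjLists n) (loc : List ℤ) (heap : List (List ℤ)) : Exp → Option ℤ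
  | .lit z => some z
  | .var x => loc[x]?
  | .size => some (n : ℤ)
  | .deg v => (v.eval A loc heap).bind fun z => degAt A z
  | .nbr v i => (v.eval A loc heap).bind fun z => (i.eval A loc heap).bind fun j => nbrAt A z j
  | .get a i => heap[a]?.bind fun l => (i.eval A loc heap).bind fun j => readAt l j
  | .add e f => (e.eval A loc heap).bind fun x => (f.eval A loc heap).bind fun y => some (x + y)
  | .sub e f => (e.eval A loc heap).bind fun x => (f.eval A loc heap).bind fun y => some (x - y)
  | .mul e f => (e.eval A loc heap).bind fun x => (f.eval A loc heap).bind fun y => some (x * y)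

/-- The number of elementary operations of an evaluation: one per node of the expression. -/
def Exp.cost : Exp → ℕ
  | .lit _ => 1
  | .var _ => 1
  | .size => 1
  | .deg v => v.cost + 1
  | .nbr v i => v.cost + i.cost + 1
  | .get _ i => i.cost + 1
  | .add e f => e.cost + f.cost + 1
  | .sub e f => e.cost + f.cost + 1
  | .mul e f => e.cost + f.cost + 1

/-- Tests. -/
inductive Test : Type
  | lt (e f : Exp)
  | ne (e f : Exp)

/-- The outcome of a test. -/
def Test.eval {n : ℕ} (A : AdjLists n) (loc : List ℤ) (heap : List (List ℤ)) : Test → Option Bool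
  | .lt e f => (e.eval A loc heap).bind fun x => (f.eval A loc heap).bind fun y =>
      some (decide (x < y))
  | .ne e f => (e.eval A loc heap).bind fun x => (f.eval A loc heap).bind fun y =>
      some (decide (x ≠ y))

/-- The number of elementary operations of a test. -/
def Test.cost : Test → ℕ
  | .lt e f => e.cost + f.cost + 1
  | .ne e f => e.cost + f.cost + 1

/-- Statements. -/
inductive Stmt : Type
  /-- `x := e` for a local variable `x` -/
  | assign (x : ℕ) (e : Exp)
  /-- `a[i] := e` for a working array `a` -/
  | store (a : ℕ) (i e : Exp)
  /-- make `a` an array of length `e` filled with zeros -/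
  | alloc (a : ℕ) (e : Exp)
  /-- run `body` if the test `c` succeeds, and do nothing otherwise -/
  | cond (c : Test) (body : List Stmt)
  /-- run `body` as long as the test `c` succeeds -/
  | loop (c : Test) (body : List Stmt)
  /-- `x := p(args)` for the procedure number `p`, by value -/
  | call (x p : ℕ) (args : List Exp)
  /-- return the value of `e` to the caller -/
  | ret (e : Exp)

/-- A procedure: the number of its local variables, the first of which hold the arguments, and
its body. -/
structure Proc : Type where
  locals : ℕ
  body : List Stmt

/-- A program: its procedures, the number of its working arrays, its main procedure, and the two
local variables of the main procedure that hold the numerator and the denominator of the result at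
the end of a computation. -/
structure Program : Type where
  procs : List Proc
  arrays : ℕ
  main : Proc
  num : ℕ
  den : ℕ

/-- The record of a suspended call: what its caller has still to do, the local variables of the
caller, and the variable that receives the returned value. -/
structure Act : Type where
  code : List Stmt
  loc : List ℤ
  dest : ℕ

/-- A configuration: the statements that the current procedure has still to run, its local
variables, the suspended callers, the working arrays, and the time that has passed. -/
structure Config : Type where
  code : List Stmt
  loc : List ℤ
  stack : List Act
  heap : List (List ℤ)
  clock : ℕ

/-- The values of the arguments of a call. -/
def evalArgs {n : ℕ} (A : AdjLists n) (loc : List ℤ) (heap : List (List ℤ)) :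
    List Exp → Option (List ℤ)
  | [] => some []
  | e :: es => (e.eval A loc heap).bind fun z => (evalArgs A loc heap es).bind fun zs =>
      some (z :: zs)

/-- One step of a computation.  It fails if nothing is left to do, or if the next statement reads
or writes a variable, an array entry or a procedure that does not exist.  A step takes one unit of
time, one more for each elementary operation in its expressions, and one more for each word that
it sets aside for an array or for the local variables of a procedure. -/
def step (P : Program) {n : ℕ} (A : AdjLists n) (c : Config) : Option Config :=
  match c.code with
  | [] => none
  | .assign x e :: rest =>
      (e.eval A c.loc c.heap).bind fun z =>
      if x < c.loc.length then
        some { c with code := rest, loc := c.loc.set x z, clock := c.clock + 1 + e.cost }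
      else none
  | .store a i e :: rest =>
      (i.eval A c.loc c.heap).bind fun j =>
      (e.eval A c.loc c.heap).bind fun z =>
      c.heap[a]?.bind fun l =>
      (writeAt l j z).bind fun l' =>
      some { c with
        code := rest, heap := c.heap.set a l', clock := c.clock + 1 + i.cost + e.cost }
  | .alloc a e :: rest =>
      (e.eval A c.loc c.heap).bind fun z =>
      if a < c.heap.length ∧ 0 ≤ z then
        some { c with
          code := rest, heap := c.heap.set a (List.replicate z.toNat 0),
          clock := c.clock + 1 + e.cost + z.toNat }
      else none
  | .cond t body :: rest =>
      (t.eval A c.loc c.heap).bind fun b =>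
      some { c with
        code := if b then body ++ rest else rest, clock := c.clock + 1 + t.cost }
  | .loop t body :: rest =>
      (t.eval A c.loc c.heap).bind fun b =>
      some { c with
        code := if b then body ++ .loop t body :: rest else rest,
        clock := c.clock + 1 + t.cost }
  | .call x p args :: rest =>
      P.procs[p]?.bind fun q =>
      (evalArgs A c.loc c.heap args).bind fun zs =>
      if zs.length ≤ q.locals then
        some
          { code := q.body
            loc := zs ++ List.replicate (q.locals - zs.length) 0
            stack := { code := rest, loc := c.loc, dest := x } :: c.stack
            heap := c.heap
            clock := c.clock + 1 + (args.map Exp.cost).sum + q.locals }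
      else none
  | .ret e :: _ =>
      (e.eval A c.loc c.heap).bind fun z =>
      match c.stack with
      | [] => none
      | act :: stack =>
          if act.dest < act.loc.length then
            some
              { code := act.code
                loc := act.loc.set act.dest z
                stack := stack
                heap := c.heap
                clock := c.clock + 1 + e.cost }
          else none

/-- The initial configuration. -/
def Program.init (P : Program) : Config where
  code := P.main.body
  loc := List.replicate P.main.locals 0
  stack := []
  heap := List.replicate P.arrays []
  clock := 0

/-- The configuration after `k` steps on the input `A`, if there are so many. -/
def Program.run (P : Program) {n : ℕ} (A : AdjLists n) : ℕ → Option Config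
  | 0 => some P.init
  | k + 1 => (P.run A k).bind (step P A)

/-- The computation has come to its end in the configuration `c`, with the result `p / q`. -/
def Program.Returns (P : Program) (c : Config) (p q : ℤ) : Prop :=
  c.code = [] ∧ c.stack = [] ∧ c.loc[P.num]? = some p ∧ c.loc[P.den]? = some q

/-- All words that the working memory holds: the local variables of the current procedure and of
its suspended callers, and the entries of the arrays. -/
def Config.words (c : Config) : List ℤ :=
  c.loc ++ c.stack.flatMap Act.loc ++ c.heap.flatten

/-- The space in use: the input, the words of the working memory, and the control information, one
unit for each pending statement and for each suspended call. -/
def Config.space {n : ℕ} (A : AdjLists n) (c : Config) : ℕ :=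
  A.size + c.words.length + c.code.length + (c.stack.map fun act => act.code.length + 1).sum

/-! ## The algorithm

The set `S` of the directional subtree sizes is kept in three arrays `src`, `dst`, `siz`: entry
number `k` stands for the triple `(src[k], dst[k], siz[k])`.  The array `cnt` of length `1` holds
the number of triples found so far. -/

/-- The numbers of the working arrays. -/
abbrev cnt : ℕ := 0
abbrev src : ℕ := 1
abbrev dst : ℕ := 2
abbrev siz : ℕ := 3
abbrev acc : ℕ := 4

/-- The recursive procedure of two adjacent vertices `u`, `v`: it returns the number `s` of vertices
of the subtree of `v` with respect to the root `u`, and it adds the triples `(a, b, s_a(b))` and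
`(b, a, s_b(a))` to `S` for the edge `ab = uv` and for every edge `ab` of that subtree.

Local variables: `0 = u`, `1 = v`, `2 = s`, `3 = i`, `4 = w`, `5 = r`, `6 = k`.
```
s := 1
for w in the neighbours of v:
  if w ≠ u:
    r := sizes(v, w)
    s := s + r
S := S ∪ {(u, v, s), (v, u, n - s)}
return s
``` -/
def sizesProc : Proc where
  locals := 7
  body :=
    [ .assign 2 (.lit 1),
      .assign 3 (.lit 0),
      .loop (.lt (.var 3) (.deg (.var 1)))
        [ .assign 4 (.nbr (.var 1) (.var 3)),
          .cond (.ne (.var 4) (.var 0))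
            [ .call 5 0 [.var 1, .var 4],
              .assign 2 (.add (.var 2) (.var 5)) ],
          .assign 3 (.add (.var 3) (.lit 1)) ],
      .assign 6 (.get cnt (.lit 0)),
      .store src (.var 6) (.var 0),
      .store dst (.var 6) (.var 1),
      .store siz (.var 6) (.var 2),
      .assign 6 (.add (.var 6) (.lit 1)),
      .store src (.var 6) (.var 1),
      .store dst (.var 6) (.var 0),
      .store siz (.var 6) (.sub .size (.var 2)),
      .assign 6 (.add (.var 6) (.lit 1)),
      .store cnt (.lit 0) (.var 6),
      .ret (.var 2) ]

/-- The main procedure.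

Local variables: `0 = i`, `1 = w`, `2 = r`, `3 = k`, `4 = u`, `5 = t`, `6` and `7` for the result.
```
S := ∅
for w in the neighbours of the vertex 0:
  r := sizes(0, w)
L := a vector of n zeros                           (the array acc)
for (u, v, s) in S:
  L[u] := L[u] + s ^ 2
t := sum over all vertices u of (2 deg u - 1) L[u]
return ((n - 1) (3 n ^ 2 + 2 n - 2) - t) / (6 n)
``` -/
def mainProc : Proc where
  locals := 8
  body :=
    [ .alloc cnt (.lit 1),
      .alloc src (.mul (.lit 2) (.sub .size (.lit 1))),
      .alloc dst (.mul (.lit 2) (.sub .size (.lit 1))),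
      .alloc siz (.mul (.lit 2) (.sub .size (.lit 1))),
      .assign 0 (.lit 0),
      .loop (.lt (.var 0) (.deg (.lit 0)))
        [ .assign 1 (.nbr (.lit 0) (.var 0)),
          .call 2 0 [.lit 0, .var 1],
          .assign 0 (.add (.var 0) (.lit 1)) ],
      .alloc acc .size,
      .assign 3 (.lit 0),
      .loop (.lt (.var 3) (.get cnt (.lit 0)))
        [ .assign 4 (.get src (.var 3)),
          .store acc (.var 4)
            (.add (.get acc (.var 4)) (.mul (.get siz (.var 3)) (.get siz (.var 3)))),
          .assign 3 (.add (.var 3) (.lit 1)) ],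
      .assign 4 (.lit 0),
      .assign 5 (.lit 0),
      .loop (.lt (.var 4) .size)
        [ .assign 5
            (.add (.var 5)
              (.mul (.sub (.mul (.lit 2) (.deg (.var 4))) (.lit 1)) (.get acc (.var 4)))),
          .assign 4 (.add (.var 4) (.lit 1)) ],
      .assign 6
        (.sub
          (.mul (.sub .size (.lit 1))
            (.sub
              (.add (.mul (.lit 3) (.mul .size .size)) (.mul (.lit 2) .size))
              (.lit 2)))
          (.var 5)),
      .assign 7 (.mul (.lit 6) .size) ]

/-- The algorithm: it computes all directional subtree sizes and evaluates
`(n - 1) (3 n ^ 2 + 2 n - 2) / (6 n) - (1 / (6 n)) ∑ v, (2 deg v - 1) ∑ u ∈ N(v), s_v(u) ^ 2`. -/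
def computeExpectedPlanar : Program where
  procs := [sizesProc]
  arrays := 5
  main := mainProc
  num := 6
  den := 7

end PlanarSum

namespace PlanarSum

/-! ## Directions in a tree -/

section Tree

variable {V : Type*} {G : SimpleGraph V}

open Classical in
/-- The first vertex after `u` on a path from `u` to `x`, and `u` itself if `x = u`. -/
noncomputable def toward (G : SimpleGraph V) (u x : V) : V :=
  if h : ∃ p : G.Walk u x, p.IsPath then h.choose.snd else u

theorem toward_eq_snd (hG : G.IsTree) {u x : V} (p : G.Walk u x) (hp : p.IsPath) :
    toward G u x = p.snd := by
  have h : ∃ p : G.Walk u x, p.IsPath := ⟨p, hp⟩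
  have := (hG.isAcyclic.subsingleton_path u x).elim ⟨h.choose, h.choose_spec⟩ ⟨p, hp⟩
  rw [toward, dif_pos h, show h.choose = p from congrArg Subtype.val this]

theorem toward_self (hG : G.IsTree) (u : V) : toward G u u = u := by
  simpa using toward_eq_snd hG (SimpleGraph.Walk.nil : G.Walk u u) (by simp)

theorem toward_of_adj (hG : G.IsTree) {u w : V} (h : G.Adj u w) : toward G u w = w := by
  simpa using toward_eq_snd hG (SimpleGraph.Walk.cons h .nil) (by simpa using h.ne)

theorem adj_toward (hG : G.IsTree) {u x : V} (h : x ≠ u) : G.Adj u (toward G u x) := by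
  obtain ⟨p, hp, -⟩ := hG.existsUnique_path u x
  rw [toward_eq_snd hG p hp]
  exact p.adj_snd (SimpleGraph.Walk.not_nil_of_ne h.symm)

theorem toward_ne_self (hG : G.IsTree) {u x : V} (h : x ≠ u) : toward G u x ≠ u :=
  (adj_toward hG h).ne'

theorem toward_congr (hG : G.IsTree) {u x y : V} (h : G.Adj x y) (hx : x ≠ u) (hy : y ≠ u) :
    toward G u x = toward G u y := by
  classical
  obtain ⟨p, hp, -⟩ := hG.existsUnique_path u x
  rw [toward_eq_snd hG p hp]
  cases p with
  | nil => exact absurd rfl hx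
  | cons h1 q =>
    rw [SimpleGraph.Walk.cons_isPath_iff] at hp
    have hq : u ∉ (q.concat h).bypass.support := fun hu => by
      have := (q.concat h).support_bypass_subset_support hu
      rw [SimpleGraph.Walk.support_concat, List.mem_append] at this
      rcases this with h2 | h2
      · exact hp.2 h2
      · exact hy (List.mem_singleton.1 h2).symm
    rw [toward_eq_snd hG (.cons h1 (q.concat h).bypass)
      ((SimpleGraph.Walk.cons_isPath_iff _ _).2 ⟨SimpleGraph.Walk.bypass_isPath _, hq⟩)]
    simp

/-- A property that passes along the edges of a connected graph holds everywhere if it holds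
somewhere. -/
theorem forall_of_connected (hG : G.Connected) {P : V → Prop} {u : V} (hu : P u)
    (h : ∀ s t, G.Adj s t → P s → P t) (x : V) : P x := by
  obtain ⟨p⟩ := hG.preconnected u x
  induction p with
  | nil => exact hu
  | cons h1 _ ih => exact ih (h _ _ h1 hu)

theorem toward_eq_iff_of_adj (hG : G.IsTree) {u v x y : V} (huv : G.Adj u v) (hxy : G.Adj x y)
    (h : ¬ (x = u ∧ y = v)) (h' : ¬ (x = v ∧ y = u)) :
    toward G u x = v ↔ toward G u y = v := by
  by_cases hx : x = u
  · subst hx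
    rw [toward_self hG, toward_of_adj hG hxy]
    exact ⟨fun e => absurd e huv.ne, fun e => absurd ⟨rfl, e⟩ h⟩
  by_cases hy : y = u
  · subst hy
    rw [toward_self hG, toward_of_adj hG hxy.symm]
    exact ⟨fun e => absurd ⟨e, rfl⟩ h', fun e => absurd e huv.ne⟩
  rw [toward_congr hG hxy hx hy]

/-- Every vertex lies on exactly one side of an edge. -/
theorem toward_eq_iff_ne (hG : G.IsTree) {u v : V} (huv : G.Adj u v) (x : V) :
    toward G u x = v ↔ toward G v x ≠ u := by
  have hu : toward G u u = v ↔ toward G v u ≠ u := by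
    rw [toward_self hG, toward_of_adj hG huv.symm]
    simp [huv.ne]
  have hv : toward G u v = v ↔ toward G v v ≠ u := by
    rw [toward_self hG, toward_of_adj hG huv]
    simp [huv.ne']
  refine forall_of_connected hG.1 (P := fun x => toward G u x = v ↔ toward G v x ≠ u) hu ?_ x
  intro s t hst hs
  by_cases h1 : t = u
  · rw [h1]; exact hu
  by_cases h2 : t = v
  · rw [h2]; exact hv
  rw [← toward_eq_iff_of_adj hG huv hst (fun h => h2 h.2) (fun h => h1 h.2), hs, ne_eq, ne_eq,
    toward_eq_iff_of_adj hG huv.symm hst (fun h => h1 h.2) (fun h => h2 h.2)]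

variable [Fintype V] [DecidableEq V]

/-- The vertices of the subtree of `v` with respect to the root `u`, for adjacent `u`, `v`. -/
noncomputable def branch (G : SimpleGraph V) (u v : V) : Finset V :=
  Finset.univ.filter fun x => toward G u x = v

/-- The directional subtree size `s_u(v)`. -/
noncomputable def dirSize (G : SimpleGraph V) (u v : V) : ℕ := (branch G u v).card

theorem mem_branch {u v x : V} : x ∈ branch G u v ↔ toward G u x = v := by simp [branch]

theorem dirSize_add_dirSize (hG : G.IsTree) {u v : V} (h : G.Adj u v) :
    dirSize G u v + dirSize G v u = Fintype.card V := by
  have : branch G v u = Finset.univ.filter fun x => ¬ toward G u x = v := by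
    ext x; simp [branch, toward_eq_iff_ne hG h]
  rw [dirSize, dirSize, this, branch, Finset.card_filter_add_card_filter_not]
  rfl

theorem dirSize_pos (hG : G.IsTree) {u v : V} (h : G.Adj u v) : 0 < dirSize G u v :=
  Finset.card_pos.2 ⟨v, mem_branch.2 (toward_of_adj hG h)⟩

/-- The vertices other than `u` split into the branches at `u`. -/
theorem sum_branches (hG : G.IsTree) {M : Type*} [AddCommMonoid M] (f : V → M) (u : V)
    {N : Finset V} (hN : ∀ w, w ∈ N ↔ G.Adj u w) :
    ∑ w ∈ N, ∑ x ∈ branch G u w, f x = ∑ x ∈ Finset.univ.erase u, f x := by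
  rw [← Finset.sum_fiberwise_of_maps_to (s := Finset.univ.erase u) (t := N) (g := toward G u)]
  · refine Finset.sum_congr rfl fun w hw => Finset.sum_congr ?_ fun _ _ => rfl
    ext x
    rw [mem_branch, Finset.mem_filter, Finset.mem_erase]
    refine ⟨fun h => ⟨⟨?_, Finset.mem_univ _⟩, h⟩, fun h => h.2⟩
    rintro rfl
    rw [toward_self hG] at h
    exact ((hN w).1 hw).ne h
  · intro x hx
    exact (hN _).2 (adj_toward hG (Finset.ne_of_mem_erase hx))

/-- A branch consists of its root and of the branches at its root. -/
theorem sum_branch (hG : G.IsTree) {M : Type*} [AddCommMonoid M] (f : V → M) {u v : V}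
    (h : G.Adj u v) {N : Finset V} (hN : ∀ w, w ∈ N ↔ G.Adj v w) :
    ∑ x ∈ branch G u v, f x = f v + ∑ w ∈ N.erase u, ∑ x ∈ branch G v w, f x := by
  have h1 : branch G u v = insert v ((N.erase u).biUnion (branch G v)) := by
    ext x
    simp only [mem_branch, Finset.mem_insert, Finset.mem_biUnion, Finset.mem_erase, hN]
    rw [toward_eq_iff_ne hG h]
    constructor
    · intro hx
      by_cases hxv : x = v
      · exact .inl hxv
      · exact .inr ⟨_, ⟨hx, adj_toward hG hxv⟩, rfl⟩
    · rintro (rfl | ⟨w, ⟨h2, -⟩, rfl⟩)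
      · rw [toward_self hG]; exact h.ne'
      · exact h2
  rw [h1, Finset.sum_insert, Finset.sum_biUnion]
  · intro a _ b _ hab
    rw [Function.onFun, Finset.disjoint_left]
    intro x hx hx'
    exact hab ((mem_branch.1 hx).symm.trans (mem_branch.1 hx'))
  · simp only [mem_branch, Finset.mem_biUnion, Finset.mem_erase, hN, toward_self hG]
    rintro ⟨w, ⟨-, h2⟩, rfl⟩
    exact h2.ne rfl

theorem dirSize_eq (hG : G.IsTree) {u v : V} (h : G.Adj u v) {N : Finset V}
    (hN : ∀ w, w ∈ N ↔ G.Adj v w) :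
    dirSize G u v = 1 + ∑ w ∈ N.erase u, dirSize G v w := by
  simpa only [dirSize, Finset.card_eq_sum_ones] using sum_branch hG (fun _ => 1) h hN

theorem sum_dirSize (hG : G.IsTree) (u : V) {N : Finset V} (hN : ∀ w, w ∈ N ↔ G.Adj u w) :
    ∑ w ∈ N, dirSize G u w = Fintype.card V - 1 := by
  have := sum_branches hG (fun _ => 1) u hN
  simpa [dirSize, Finset.card_erase_of_mem] using this

end Tree

/-! ## Symmetries of the planar arrangements of a tree -/

section Symmetry

variable {n : ℕ}

theorem exists_perm_lt_iff {α : Type*} [LinearOrder α] (f : Fin n → α)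
    (hf : Function.Injective f) : ∃ π : Equiv.Perm (Fin n), ∀ x y, π x < π y ↔ f x < f y := by
  have h : StrictMono (f ∘ Tuple.sort f) :=
    (Tuple.monotone_sort f).strictMono_of_injective (hf.comp (Tuple.sort f).injective)
  refine ⟨(Tuple.sort f).symm, fun x y => ?_⟩
  rw [← h.lt_iff_lt]
  simp

theorem perm_eq_of_lt_iff {π π' : Equiv.Perm (Fin n)} (h : ∀ x y, π x < π y ↔ π' x < π' y) :
    π = π' := by
  let e : Fin n ≃o Fin n :=
    { toEquiv := π.symm.trans π'
      map_rel_iff' := by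
        intro a b
        have := h (π.symm b) (π.symm a)
        simp only [Equiv.apply_symm_apply] at this
        simp only [Equiv.trans_apply]
        rw [← not_lt, ← not_lt, this] }
  ext x
  have h1 : e (π x) = OrderIso.refl _ (π x) := by rw [Subsingleton.elim e (OrderIso.refl _)]
  have h2 : e (π x) = π' x := by simp [e]
  rw [← h2, h1]
  rfl

theorem val_eq_zero_iff_lt (π : Arrangement n) (u : Fin n) :
    (π u : ℕ) = 0 ↔ ∀ x, x ≠ u → π u < π x := by
  constructor
  · intro h x hx
    have : π x ≠ π u := fun e => hx (π.injective e)
    omega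
  · intro h
    by_contra h0
    have hn : 0 < n := by have := u.2; omega
    have h1 := h (π.symm ⟨0, hn⟩) (by rintro rfl; simp at h0)
    simp [Fin.lt_def] at h1

/-- The vertex `x` lies strictly between `u` and `v`. -/
def Between (π : Arrangement n) (u v x : Fin n) : Prop :=
  (π u < π x ∧ π x < π v) ∨ (π v < π x ∧ π x < π u)

variable {G : SimpleGraph (Fin n)}

theorem between_iff_of_adj {π : Arrangement n} (hπ : IsPlanar G π) {s t y z : Fin n}
    (hst : G.Adj s t) (hyz : G.Adj y z) (h1 : y ≠ s) (h2 : y ≠ t) (h3 : z ≠ s) (h4 : z ≠ t) :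
    Between π s t y ↔ Between π s t z := by
  have a1 := hπ s t y z hst hyz
  have a2 := hπ s t z y hst hyz.symm
  have a3 := hπ t s y z hst.symm hyz
  have a4 := hπ t s z y hst.symm hyz.symm
  have b1 := hπ y z s t hyz hst
  have b2 := hπ z y s t hyz.symm hst
  have b3 := hπ y z t s hyz hst.symm
  have b4 := hπ z y t s hyz.symm hst.symm
  have c1 : π y ≠ π s := fun e => h1 (π.injective e)
  have c2 : π y ≠ π t := fun e => h2 (π.injective e)
  have c3 : π z ≠ π s := fun e => h3 (π.injective e)
  have c4 : π z ≠ π t := fun e => h4 (π.injective e)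
  unfold Between
  omega

/-- An edge that does not touch a branch at `u` does not separate its vertices. -/
theorem between_iff_of_toward_eq (hG : G.IsTree) {π : Arrangement n} (hπ : IsPlanar G π)
    {u s t y z : Fin n} (hst : G.Adj s t) (hyz : toward G u y = toward G u z) (hy : y ≠ u)
    (hs : toward G u s ≠ toward G u y) (ht : toward G u t ≠ toward G u y) :
    Between π s t y ↔ Between π s t z := by
  have key : ∀ x, toward G u x = toward G u y →
      (Between π s t x ↔ Between π s t (toward G u y)) := by
    refine forall_of_connected hG.1 (u := u) ?_ ?_
    · intro h
      rw [toward_self hG] at h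
      exact absurd h.symm (toward_ne_self hG hy)
    · intro a b hab ha hb
      by_cases hau : a = u
      · rw [hau] at hab
        rw [← hb, toward_of_adj hG hab]
      · have hbu : b ≠ u := by
          rintro rfl
          rw [toward_self hG] at hb
          exact toward_ne_self hG hy hb.symm
        have hay := (toward_congr hG hab hau hbu).trans hb
        rw [← ha hay, between_iff_of_adj hπ hst hab.symm]
        · rintro rfl; exact hs hb
        · rintro rfl; exact ht hb
        · rintro rfl; exact hs hay
        · rintro rfl; exact ht hay
  rw [key y rfl, key z hyz.symm]

/-- If `u` comes first in a planar arrangement, then no vertex comes between two vertices of a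
branch at `u` to which it does not belong. -/
theorem not_between_of_toward_ne (hG : G.IsTree) {π : Arrangement n} (hπ : IsPlanar G π)
    {u y z x : Fin n} (hu : (π u : ℕ) = 0) (hyz : toward G u y = toward G u z) (hy : y ≠ u)
    (hx : toward G u x ≠ toward G u y) : ¬ Between π y z x := by
  have key : ∀ x, toward G u x ≠ toward G u y → ¬ Between π y z x := by
    have hu0 : ¬ Between π y z u := by unfold Between; omega
    refine forall_of_connected hG.1 (u := u) (fun _ => hu0) ?_
    intro s t hst hs ht
    by_cases htu : t = u
    · rw [htu]; exact hu0
    have hs' : toward G u s ≠ toward G u y := by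
      by_cases hsu : s = u
      · rw [hsu, toward_self hG]; exact (toward_ne_self hG hy).symm
      · rwa [toward_congr hG hst hsu htu]
    have h1 := hs hs'
    have h2 := between_iff_of_toward_eq hG hπ hst hyz hy hs' ht
    have c1 : π y ≠ π s := fun e => hs' (by rw [π.injective e])
    have c2 : π y ≠ π t := fun e => ht (by rw [π.injective e])
    have c3 : π z ≠ π s := fun e => hs' (by rw [hyz, π.injective e])
    have c4 : π z ≠ π t := fun e => ht (by rw [hyz, π.injective e])
    unfold Between at *
    omega
  exact key x hx

theorem lt_iff_toward_lt (hG : G.IsTree) {π : Arrangement n} (hπ : IsPlanar G π)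
    {u x y : Fin n} (hu : (π u : ℕ) = 0) (hxy : toward G u x ≠ toward G u y) :
    π x < π y ↔ π (toward G u x) < π (toward G u y) := by
  have key : ∀ x y, toward G u x ≠ toward G u y → π x < π y →
      π (toward G u x) < π (toward G u y) := by
    intro x y hxy h
    have hyu : y ≠ u := by rintro rfl; omega
    have ty : toward G u (toward G u y) = toward G u y := toward_of_adj hG (adj_toward hG hyu)
    by_cases hxu : x = u
    · rw [hxu, toward_self hG]
      exact (val_eq_zero_iff_lt π u).1 hu _ (toward_ne_self hG hyu)
    have tx : toward G u (toward G u x) = toward G u x := toward_of_adj hG (adj_toward hG hxu)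
    have h1 := not_between_of_toward_ne hG hπ hu ty.symm hyu hxy
    have h2 := not_between_of_toward_ne (x := toward G u y) hG hπ hu tx.symm hxu
      (by rw [ty]; exact hxy.symm)
    have c1 : π x ≠ π (toward G u y) := fun e => hxy (by rw [π.injective e, ty])
    have c2 : π (toward G u x) ≠ π (toward G u y) := fun e => hxy (π.injective e)
    unfold Between at h1 h2
    omega
  refine ⟨key x y hxy, fun h => ?_⟩
  by_contra h'
  have c : π x ≠ π y := fun e => hxy (by rw [π.injective e])
  have := key y x hxy.symm (by omega)
  omega

theorem regroup_key_injective (G : SimpleGraph (Fin n)) (u : Fin n) (σ : Equiv.Perm (Fin n))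
    (π : Arrangement n) :
    Function.Injective fun x => toLex (π (σ (toward G u x)), π x) :=
  fun _ _ h => π.injective (congrArg (fun p => (ofLex p).2) h)

/-- The arrangement that permutes the branches at `u` by `σ` and keeps the order in each of
them. -/
noncomputable def regroup (G : SimpleGraph (Fin n)) (u : Fin n) (σ : Equiv.Perm (Fin n))
    (π : Arrangement n) : Arrangement n :=
  (exists_perm_lt_iff _ (regroup_key_injective G u σ π)).choose

theorem regroup_lt_iff (u : Fin n) (σ : Equiv.Perm (Fin n)) (π : Arrangement n) (x y : Fin n) :
    regroup G u σ π x < regroup G u σ π y ↔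
      π (σ (toward G u x)) < π (σ (toward G u y)) ∨
        toward G u x = toward G u y ∧ π x < π y := by
  rw [regroup, (exists_perm_lt_iff _ (regroup_key_injective G u σ π)).choose_spec x y,
    Prod.Lex.toLex_lt_toLex]
  simp

theorem regroup_lt_iff_of_eq {u : Fin n} {σ : Equiv.Perm (Fin n)} {π : Arrangement n}
    {x y : Fin n} (h : toward G u x = toward G u y) :
    regroup G u σ π x < regroup G u σ π y ↔ π x < π y := by
  simp [regroup_lt_iff, h]

theorem regroup_lt_iff_of_ne {u : Fin n} {σ : Equiv.Perm (Fin n)} {π : Arrangement n}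
    {x y : Fin n} (h : toward G u x ≠ toward G u y) :
    regroup G u σ π x < regroup G u σ π y ↔
      π (σ (toward G u x)) < π (σ (toward G u y)) := by
  simp [regroup_lt_iff, h]

theorem regroup_first (hG : G.IsTree) {u : Fin n} {σ : Equiv.Perm (Fin n)} (hσ : σ u = u)
    {π : Arrangement n} (hu : (π u : ℕ) = 0) : (regroup G u σ π u : ℕ) = 0 := by
  rw [val_eq_zero_iff_lt]
  intro x hx
  have h := toward_ne_self hG hx
  rw [regroup_lt_iff_of_ne (by rw [toward_self hG]; exact h.symm), toward_self hG, hσ]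
  refine (val_eq_zero_iff_lt π u).1 hu _ fun e => h (σ.injective (e.trans hσ.symm))

theorem regroup_planar (hG : G.IsTree) {u : Fin n} {σ : Equiv.Perm (Fin n)} (hσ : σ u = u)
    {π : Arrangement n} (hπ : IsPlanar G π) (hu : (π u : ℕ) = 0) :
    IsPlanar G (regroup G u σ π) := by
  rintro a c b d hac hbd ⟨h1, h2, h3⟩
  have hu' := regroup_first hG hσ hu
  have hb : b ≠ u := by rintro rfl; omega
  have hc : c ≠ u := by rintro rfl; omega
  have hd : d ≠ u := by rintro rfl; omega
  have ebd := toward_congr hG hbd hb hd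
  have ebc : toward G u b = toward G u c := by
    by_contra hbc
    rw [regroup_lt_iff_of_ne hbc] at h2
    rw [regroup_lt_iff_of_ne (fun e => hbc (ebd.trans e.symm))] at h3
    rw [ebd] at h2
    omega
  rw [regroup_lt_iff_of_eq ebc] at h2
  rw [regroup_lt_iff_of_eq (ebc.symm.trans ebd)] at h3
  refine hπ a c b d hac hbd ⟨?_, h2, h3⟩
  by_cases ha : a = u
  · rw [ha]; exact (val_eq_zero_iff_lt π u).1 hu b hb
  · rwa [regroup_lt_iff_of_eq ((toward_congr hG hac ha hc).trans ebc.symm)] at h1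

theorem regroup_regroup (hG : G.IsTree) {u : Fin n} {σ : Equiv.Perm (Fin n)} (hσ : σ u = u)
    (hσ' : ∀ w, G.Adj u w → G.Adj u (σ w)) (hσσ : ∀ w, σ (σ w) = w)
    {π : Arrangement n} (hπ : IsPlanar G π) (hu : (π u : ℕ) = 0) :
    regroup G u σ (regroup G u σ π) = π := by
  have ht : ∀ x, toward G u (σ (toward G u x)) = σ (toward G u x) := by
    intro x
    by_cases hx : x = u
    · rw [hx, toward_self hG, hσ, toward_self hG]
    · exact toward_of_adj hG (hσ' _ (adj_toward hG hx))
  refine perm_eq_of_lt_iff fun x y => ?_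
  by_cases h : toward G u x = toward G u y
  · rw [regroup_lt_iff_of_eq h, regroup_lt_iff_of_eq h]
  · rw [regroup_lt_iff_of_ne h, regroup_lt_iff_of_ne, ht, ht, hσσ, hσσ,
      lt_iff_toward_lt hG hπ hu h]
    rw [ht, ht]
    exact fun e => h (σ.injective e)

theorem mem_planarArrangements {π : Arrangement n} :
    π ∈ planarArrangements G ↔ IsPlanar G π := by simp [planarArrangements]

/-- The planar arrangements in which `u` comes first. -/
noncomputable def planarFrom (G : SimpleGraph (Fin n)) (u : Fin n) : Finset (Arrangement n) :=
  (planarArrangements G).filter fun π => (π u : ℕ) = 0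

theorem mem_planarFrom {u : Fin n} {π : Arrangement n} :
    π ∈ planarFrom G u ↔ IsPlanar G π ∧ (π u : ℕ) = 0 := by
  simp [planarFrom, mem_planarArrangements]

/-- Exchanging two branches at `u` is a symmetry of the planar arrangements that start at `u`. -/
theorem card_filter_regroup (hG : G.IsTree) {u v w : Fin n} (hv : G.Adj u v) (hw : G.Adj u w)
    (p q : Arrangement n → Prop) [DecidablePred p] [DecidablePred q]
    (h : ∀ π ∈ planarFrom G u, p (regroup G u (Equiv.swap v w) π) ↔ q π) :
    ((planarFrom G u).filter p).card = ((planarFrom G u).filter q).card := by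
  have hσ : Equiv.swap v w u = u := Equiv.swap_apply_of_ne_of_ne hv.ne hw.ne
  have hσ' : ∀ x, G.Adj u x → G.Adj u (Equiv.swap v w x) := by
    intro x hx
    rw [Equiv.swap_apply_def]
    split_ifs <;> assumption
  have hm : ∀ π ∈ planarFrom G u, regroup G u (Equiv.swap v w) π ∈ planarFrom G u := by
    intro π hπ
    rw [mem_planarFrom] at hπ ⊢
    exact ⟨regroup_planar hG hσ hπ.1 hπ.2, regroup_first hG hσ hπ.2⟩
  have hi : ∀ π ∈ planarFrom G u,
      regroup G u (Equiv.swap v w) (regroup G u (Equiv.swap v w) π) = π := by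
    intro π hπ
    rw [mem_planarFrom] at hπ
    exact regroup_regroup hG hσ hσ' (Equiv.swap_apply_self v w) hπ.1 hπ.2
  symm
  refine Finset.card_bij' (fun π _ => regroup G u (Equiv.swap v w) π)
    (fun π _ => regroup G u (Equiv.swap v w) π) ?_ ?_ ?_ ?_
  · intro π hπ
    rw [Finset.mem_filter] at hπ ⊢
    exact ⟨hm π hπ.1, (h π hπ.1).2 hπ.2⟩
  · intro π hπ
    rw [Finset.mem_filter] at hπ ⊢
    refine ⟨hm π hπ.1, (h _ (hm π hπ.1)).1 ?_⟩
    rw [hi π hπ.1]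
    exact hπ.2
  · intro π hπ
    exact hi π (Finset.mem_filter.1 hπ).1
  · intro π hπ
    exact hi π (Finset.mem_filter.1 hπ).1

/-! ### Rotations -/

/-- The cyclic shift of an arrangement by `k` positions. -/
def rotate (k : Fin n) (π : Arrangement n) : Arrangement n :=
  haveI : NeZero n := ⟨fun h => by have := k.2; omega⟩
  π.trans (Equiv.addRight k)

theorem rotate_val (k : Fin n) (π : Arrangement n) (x : Fin n) :
    (rotate k π x : ℕ) = if n ≤ π x + k then (π x + k - n : ℕ) else (π x + k : ℕ) := by
  have : NeZero n := ⟨fun h => by have := k.2; omega⟩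
  simp only [rotate, Equiv.trans_apply, Equiv.coe_addRight]
  exact Fin.val_add_eq_ite _ _

theorem rotate_planar {π : Arrangement n} (hπ : IsPlanar G π) (k : Fin n) :
    IsPlanar G (rotate k π) := by
  rintro a c b d hac hbd h
  simp only [Fin.lt_def, rotate_val] at h
  have a1 := hπ a c b d hac hbd
  have a2 := hπ b d c a hbd hac.symm
  have a3 := hπ c a d b hac.symm hbd.symm
  have a4 := hπ d b a c hbd.symm hac
  simp only [Fin.lt_def] at a1 a2 a3 a4
  split_ifs at h <;> omega

/-- The chord `uv` separates `x` and `y` if the positions are thought of as lying on a circle. -/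
def Separates (π : Arrangement n) (u v x y : Fin n) : Prop :=
  (x ≠ u ∧ x ≠ v ∧ y ≠ u ∧ y ≠ v) ∧ (Between π u v x ↔ ¬ Between π u v y)

theorem separates_rotate (k : Fin n) (π : Arrangement n) (u v x y : Fin n) :
    Separates (rotate k π) u v x y ↔ Separates π u v x y := by
  unfold Separates
  refine and_congr_right fun ⟨h1, h2, h3, h4⟩ => ?_
  have c1 : (π x : ℕ) ≠ π u := fun e => h1 (π.injective (Fin.ext e))
  have c2 : (π x : ℕ) ≠ π v := fun e => h2 (π.injective (Fin.ext e))
  have c3 : (π y : ℕ) ≠ π u := fun e => h3 (π.injective (Fin.ext e))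
  have c4 : (π y : ℕ) ≠ π v := fun e => h4 (π.injective (Fin.ext e))
  have hk := k.2
  simp only [Between, Fin.lt_def, rotate_val]
  generalize hu : (π u : ℕ) = a at *
  generalize hv : (π v : ℕ) = b at *
  generalize hx : (π x : ℕ) = c at *
  generalize hy : (π y : ℕ) = d at *
  have : a < n := hu ▸ (π u).2
  have : b < n := hv ▸ (π v).2
  have : c < n := hx ▸ (π x).2
  have : d < n := hy ▸ (π y).2
  clear hu hv hx hy
  split_ifs <;> omega

/-- A rotation invariant property is `n` times as frequent among all planar arrangements as among
those that start at `u`. -/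
theorem card_filter_rotate (u : Fin n) (p : Arrangement n → Prop)
    [DecidablePred p] (hp : ∀ k π, p (rotate k π) ↔ p π) :
    ((planarArrangements G).filter p).card = n * ((planarFrom G u).filter p).card := by
  have : NeZero n := ⟨fun h => by have := u.2; omega⟩
  have h1 := Finset.card_eq_sum_card_fiberwise (s := (planarArrangements G).filter p)
    (t := Finset.univ) (f := fun π : Arrangement n => π u)
    (fun _ _ => Finset.mem_coe.2 (Finset.mem_univ _))
  rw [h1, Finset.sum_const_nat (m := ((planarFrom G u).filter p).card)]
  · simp
  intro j _
  refine Finset.card_bij' (fun π _ => rotate (-j) π) (fun π _ => rotate j π) ?_ ?_ ?_ ?_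
  · intro π hπ
    simp only [Finset.mem_filter, mem_planarArrangements, mem_planarFrom] at hπ ⊢
    refine ⟨⟨rotate_planar hπ.1.1 _, ?_⟩, (hp _ _).2 hπ.1.2⟩
    simp [rotate, hπ.2]
  · intro π hπ
    simp only [Finset.mem_filter, mem_planarArrangements, mem_planarFrom] at hπ ⊢
    refine ⟨⟨rotate_planar hπ.1.1 _, (hp _ _).2 hπ.2⟩, ?_⟩
    have : π u = 0 := Fin.ext hπ.1.2
    simp [rotate, this]
  · intro π _
    ext x
    simp [rotate]
  · intro π _
    ext x
    simp [rotate]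

end Symmetry

/-! ## The expected length of an edge -/

section Expectation

variable {n : ℕ} {G : SimpleGraph (Fin n)}

open Classical in
theorem card_planarArrangements_eq (u : Fin n) :
    (planarArrangements G).card = n * (planarFrom G u).card := by
  simpa using card_filter_rotate (G := G) u (fun _ => True) (fun _ _ => Iff.rfl)

open Classical in
/-- Two vertices in different branches at `u` are separated by the edge from `u` to a third branch
with probability `1 / 3`. -/
theorem three_mul_card_separates (hG : G.IsTree) {u v x y : Fin n} (hv : G.Adj u v) (hx : x ≠ u)
    (hy : y ≠ u) (hxy : toward G u x ≠ toward G u y) (hxv : toward G u x ≠ v)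
    (hyv : toward G u y ≠ v) :
    3 * ((planarArrangements G).filter fun π => Separates π u v x y).card =
      (planarArrangements G).card := by
  rw [card_filter_rotate u _ fun k π => separates_rotate k π u v x y,
    card_planarArrangements_eq u]
  have hw := adj_toward hG hx
  have hw' := adj_toward hG hy
  have hsep : ∀ π ∈ planarFrom G u,
      (Separates π u v x y ↔ Between π (toward G u x) (toward G u y) v) := by
    intro π hπ
    rw [mem_planarFrom] at hπ
    have tv := toward_of_adj hG hv
    have h1 := lt_iff_toward_lt hG hπ.1 hπ.2 (x := x) (y := v) (by rwa [tv])
    have h2 := lt_iff_toward_lt hG hπ.1 hπ.2 (x := y) (y := v) (by rwa [tv])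
    rw [tv] at h1 h2
    have hxv' : x ≠ v := fun e => hxv (by rw [e, tv])
    have hyv' : y ≠ v := fun e => hyv (by rw [e, tv])
    have c1 := (val_eq_zero_iff_lt π u).1 hπ.2 x hx
    have c2 := (val_eq_zero_iff_lt π u).1 hπ.2 y hy
    have c3 : π (toward G u x) ≠ π v := fun e => hxv (π.injective e)
    have c4 : π (toward G u y) ≠ π v := fun e => hyv (π.injective e)
    unfold Separates Between
    simp only [ne_eq, hx, hxv', hy, hyv', not_false_eq_true, true_and]
    omega
  rw [Finset.filter_congr hsep]
  generalize hw0 : toward G u x = w at *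
  generalize hw0' : toward G u y = w' at *
  have mem : ∀ {π a b}, π ∈ planarFrom G u → G.Adj u a → G.Adj u b → a ≠ b →
      ∀ σ : Equiv.Perm (Fin n),
      (regroup G u σ π a < regroup G u σ π b ↔ π (σ a) < π (σ b)) := by
    intro π a b _ ha hb hab σ
    rw [regroup_lt_iff_of_ne, toward_of_adj hG ha, toward_of_adj hG hb]
    rwa [toward_of_adj hG ha, toward_of_adj hG hb]
  have e1 : ((planarFrom G u).filter fun π => Between π w w' v).card =
      ((planarFrom G u).filter fun π => Between π v w' w).card := by
    refine card_filter_regroup hG hv hw _ _ fun π hπ => ?_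
    unfold Between
    rw [mem hπ hw hv hxv, mem hπ hv hw' hyv.symm, mem hπ hw' hv hyv,
      mem hπ hv hw hxv.symm, Equiv.swap_apply_left, Equiv.swap_apply_right,
      Equiv.swap_apply_of_ne_of_ne hyv hxy.symm]
  have e2 : ((planarFrom G u).filter fun π => Between π w w' v).card =
      ((planarFrom G u).filter fun π => Between π w v w').card := by
    refine card_filter_regroup hG hv hw' _ _ fun π hπ => ?_
    unfold Between
    rw [mem hπ hw hv hxv, mem hπ hv hw' hyv.symm, mem hπ hw' hv hyv,
      mem hπ hv hw hxv.symm, Equiv.swap_apply_left, Equiv.swap_apply_right,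
      Equiv.swap_apply_of_ne_of_ne hxv hxy]
  have e3 : (planarFrom G u).card = ((planarFrom G u).filter fun π => Between π w w' v).card +
      ((planarFrom G u).filter fun π => Between π v w' w).card +
      ((planarFrom G u).filter fun π => Between π w v w').card := by
    simp only [Finset.card_filter, ← Finset.sum_add_distrib]
    rw [Finset.card_eq_sum_ones]
    refine Finset.sum_congr rfl fun π _ => ?_
    have c1 : π w ≠ π v := fun e => hxv (π.injective e)
    have c2 : π w' ≠ π v := fun e => hyv (π.injective e)
    have c3 : π w ≠ π w' := fun e => hxy (π.injective e)
    unfold Between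
    split_ifs <;> omega
  rw [← e1, ← e2] at e3
  rw [e3]
  ring

open Classical in
/-- Two vertices on different sides of an edge `uv` are separated by it with probability
`1 / 2`. -/
theorem two_mul_card_separates (hG : G.IsTree) {u v x y : Fin n} (hv : G.Adj u v) (hxu : x ≠ u)
    (hyv : y ≠ v) (hx : toward G u x ≠ v) (hy : toward G v y ≠ u) :
    2 * ((planarArrangements G).filter fun π => Separates π u v x y).card =
      (planarArrangements G).card := by
  rw [card_filter_rotate v _ fun k π => separates_rotate k π u v x y,
    card_planarArrangements_eq v]
  have hxv : x ≠ v := fun e => hx (by rw [e, toward_of_adj hG hv])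
  have hyu : y ≠ u := fun e => hy (by rw [e, toward_of_adj hG hv.symm])
  have tu := toward_of_adj hG hv.symm
  have hxt : toward G v x = toward G v u := by
    rw [tu]
    by_contra h
    exact hx ((toward_eq_iff_ne hG hv x).2 h)
  have hw := adj_toward hG hyv
  have tw := toward_of_adj hG hw
  have e1 : ((planarFrom G v).filter fun π => Separates π u v x y).card =
      ((planarFrom G v).filter fun π => ¬ Separates π u v x y).card := by
    refine card_filter_regroup hG hv.symm hw _ _ fun π hπ => ?_
    have hπ' := mem_planarFrom.1 hπ
    have hσ : Equiv.swap u (toward G v y) v = v :=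
      Equiv.swap_apply_of_ne_of_ne hv.ne' hw.ne
    have hv0 := regroup_first hG hσ hπ'.2
    have h1 := regroup_lt_iff_of_eq (σ := Equiv.swap u (toward G v y)) (π := π) hxt
    have h2 := regroup_lt_iff_of_ne (σ := Equiv.swap u (toward G v y)) (π := π)
      (x := y) (y := u) (by rwa [tu])
    rw [tu, Equiv.swap_apply_left, Equiv.swap_apply_right] at h2
    have h3 := lt_iff_toward_lt hG hπ'.1 hπ'.2 (x := y) (y := u) (by rwa [tu])
    rw [tu] at h3
    have a1 := (val_eq_zero_iff_lt _ v).1 hπ'.2 x hxv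
    have a2 := (val_eq_zero_iff_lt _ v).1 hπ'.2 y hyv
    have a3 := (val_eq_zero_iff_lt _ v).1 hv0 x hxv
    have a4 := (val_eq_zero_iff_lt _ v).1 hv0 y hyv
    have c : π (toward G v y) ≠ π u := fun e => hy (π.injective e)
    unfold Separates Between
    simp only [ne_eq, hxu, hxv, hyu, hyv, not_false_eq_true, true_and]
    generalize regroup G v (Equiv.swap u (toward G v y)) π = τ at *
    omega
  have e2 := Finset.card_filter_add_card_filter_not (s := planarFrom G v)
    (fun π => Separates π u v x y)
  rw [← e1] at e2
  rw [← e2]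
  ring

open Classical in
/-- Two vertices in the same branch at `u` are not separated by an edge from `u` to another
branch. -/
theorem card_separates_eq_zero (hG : G.IsTree) {u v x y : Fin n} (hv : G.Adj u v)
    (hxy : toward G u x = toward G u y) (hxv : toward G u x ≠ v) :
    ((planarArrangements G).filter fun π => Separates π u v x y).card = 0 := by
  rw [card_filter_rotate u _ fun k π => separates_rotate k π u v x y]
  rw [Finset.filter_false_of_mem, Finset.card_empty, mul_zero]
  intro π hπ hs
  rw [mem_planarFrom] at hπ
  have tv := toward_of_adj hG hv
  have h1 := lt_iff_toward_lt hG hπ.1 hπ.2 (x := x) (y := v) (by rwa [tv])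
  have h2 := lt_iff_toward_lt hG hπ.1 hπ.2 (x := y) (y := v) (by rwa [tv, ← hxy])
  have c1 := (val_eq_zero_iff_lt π u).1 hπ.2 x hs.1.1
  have c2 := (val_eq_zero_iff_lt π u).1 hπ.2 y hs.1.2.2.1
  rw [← hxy] at h2
  have := hs.2
  unfold Between at this
  omega

/-- The distance of two vertices in an arrangement. -/
def gap (π : Arrangement n) (u v : Fin n) : ℤ := |((π u : ℕ) : ℤ) - ((π v : ℕ) : ℤ)|

theorem sum_gap_rotate (π : Arrangement n) (u v : Fin n) :
    ∑ k, gap (rotate k π) u v = 2 * (gap π u v * (n - gap π u v)) := by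
  have : NeZero n := ⟨fun h => by have := u.2; omega⟩
  have hs : ∀ x : Fin n, ∑ k, ((rotate k π x : ℕ) : ℤ) = ∑ k : Fin n, ((k : ℕ) : ℤ) := fun x =>
    Equiv.sum_comp (Equiv.addLeft (π x)) fun k : Fin n => ((k : ℕ) : ℤ)
  have hn : (n : ℤ) ≠ 0 := by exact_mod_cast NeZero.ne n
  set d : ℤ := ((π u : ℕ) : ℤ) - ((π v : ℕ) : ℤ) with hd
  have key : ∀ k : Fin n, n * gap (rotate k π) u v =
      (if 0 ≤ d then 2 * d - n else 2 * d + n) *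
        (((rotate k π u : ℕ) : ℤ) - ((rotate k π v : ℕ) : ℤ)) + 2 * (|d| * (n - |d|)) := by
    intro k
    have hk := k.2
    have h1 := (π u).2
    have h2 := (π v).2
    have hu : ((rotate k π u : ℕ) : ℤ) = (π u : ℕ) + (k : ℕ) ∨
        ((rotate k π u : ℕ) : ℤ) = (π u : ℕ) + (k : ℕ) - n := by
      rw [rotate_val]; split_ifs <;> omega
    have hv : ((rotate k π v : ℕ) : ℤ) = (π v : ℕ) + (k : ℕ) ∨
        ((rotate k π v : ℕ) : ℤ) = (π v : ℕ) + (k : ℕ) - n := by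
      rw [rotate_val]; split_ifs <;> omega
    have h3 := (rotate k π u).2
    have h4 := (rotate k π v).2
    unfold gap
    have hcase : ((rotate k π u : ℕ) : ℤ) - ((rotate k π v : ℕ) : ℤ) = d ∨
        0 < d ∧ ((rotate k π u : ℕ) : ℤ) - ((rotate k π v : ℕ) : ℤ) = d - n ∨
        d < 0 ∧ ((rotate k π u : ℕ) : ℤ) - ((rotate k π v : ℕ) : ℤ) = d + n := by omega
    have hdn : d < n ∧ -n < d := by omega
    rcases hcase with h | ⟨h0, h⟩ | ⟨h0, h⟩
    · rw [h]
      split_ifs with h5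
      · rw [abs_of_nonneg h5]; ring
      · rw [abs_of_neg (not_le.1 h5)]; ring
    · rw [h, if_pos h0.le, abs_of_pos h0, abs_of_neg (by linarith)]; ring
    · rw [h, if_neg (not_le.2 h0), abs_of_neg h0, abs_of_pos (by linarith)]; ring
  apply mul_left_cancel₀ hn
  rw [Finset.mul_sum, Finset.sum_congr rfl fun k _ => key k, Finset.sum_add_distrib,
    ← Finset.mul_sum, Finset.sum_sub_distrib, hs, hs]
  simp [gap, ← hd]

theorem sum_gap (u v : Fin n) :
    n * ∑ π ∈ planarArrangements G, gap π u v =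
      ∑ π ∈ planarArrangements G, 2 * (gap π u v * (n - gap π u v)) := by
  have : NeZero n := ⟨fun h => by have := u.2; omega⟩
  simp only [← sum_gap_rotate]
  rw [Finset.sum_comm]
  have : ∀ k : Fin n, ∑ π ∈ planarArrangements G, gap (rotate k π) u v =
      ∑ π ∈ planarArrangements G, gap π u v := by
    intro k
    refine Finset.sum_bij' (fun π _ => rotate k π) (fun π _ => rotate (-k) π) ?_ ?_ ?_ ?_ ?_
    · intro π hπ
      exact mem_planarArrangements.2 (rotate_planar (mem_planarArrangements.1 hπ) _)
    · intro π hπ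
      exact mem_planarArrangements.2 (rotate_planar (mem_planarArrangements.1 hπ) _)
    · intro π _
      ext x
      simp [rotate]
    · intro π _
      ext x
      simp [rotate]
    · intro π _
      rfl
  rw [Finset.sum_congr rfl fun k _ => this k]
  simp

open Classical in
theorem card_between (π : Arrangement n) {u v : Fin n} (h : u ≠ v) :
    ((Finset.univ.filter fun x => Between π u v x).card : ℤ) = gap π u v - 1 := by
  have key : ∀ u v : Fin n, π u < π v →
      ((Finset.univ.filter fun x => Between π u v x).card : ℤ) = gap π u v - 1 := by
    intro u v huv
    have : (Finset.univ.filter fun x => Between π u v x) =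
        (Finset.Ioo (π u) (π v)).map π.symm.toEmbedding := by
      ext x
      rw [Finset.mem_filter]
      simp only [Finset.mem_univ, true_and, Between, Finset.mem_map_equiv, Equiv.symm_symm,
        Finset.mem_Ioo]
      omega
    rw [this, Finset.card_map, Fin.card_Ioo, gap, abs_of_neg (by omega)]
    omega
  rcases lt_or_gt_of_ne (fun e => h (π.injective e)) with h1 | h1
  · exact key u v h1
  · have := key v u h1
    rw [gap, abs_sub_comm] at this
    rw [gap, ← this]
    congr 2
    ext x
    rw [Finset.mem_filter, Finset.mem_filter]
    simp [Between, or_comm]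

open Classical in
theorem sum_separates (π : Arrangement n) {u v : Fin n} (h : u ≠ v) :
    ∑ x, ∑ y, (if Separates π u v x y then (1 : ℤ) else 0) =
      2 * ((gap π u v - 1) * (n - gap π u v - 1)) := by
  set W : Finset (Fin n) := Finset.univ.filter fun x => x ≠ u ∧ x ≠ v with hW
  set b : Fin n → ℤ := fun x => if Between π u v x then 1 else 0 with hb
  have hWc : (W.card : ℤ) = n - 2 := by
    have : W = Finset.univ \ {u, v} := by ext x; simp [hW]
    have h2 : 2 ≤ n := by have := u.2; have := v.2; omega
    rw [this, Finset.card_univ_sdiff, Fintype.card_fin, Finset.card_pair h]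
    omega
  have hbs : ∑ x ∈ W, b x = gap π u v - 1 := by
    rw [← card_between π h, Finset.card_filter, hW, Finset.sum_filter]
    push_cast
    refine Finset.sum_congr rfl fun x _ => ?_
    simp only [hb]
    split_ifs with h1 h2 h2
    · rfl
    · rfl
    · exfalso
      apply h1
      constructor <;> (rintro rfl; unfold Between at h2; omega)
    · rfl
  have e : ∀ x y, (if Separates π u v x y then (1 : ℤ) else 0) =
      if x ≠ u ∧ x ≠ v then (if y ≠ u ∧ y ≠ v then b x + b y - 2 * (b x * b y) else 0) else 0 := by
    intro x y
    by_cases h1 : x ≠ u ∧ x ≠ v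
    · by_cases h2 : y ≠ u ∧ y ≠ v
      · rw [if_pos h1, if_pos h2]
        by_cases h3 : Between π u v x <;> by_cases h4 : Between π u v y <;>
          simp [Separates, hb, h1, h2, h3, h4]
      · rw [if_pos h1, if_neg h2, if_neg fun hs => h2 hs.1.2.2]
    · rw [if_neg h1, if_neg fun hs => h1 ⟨hs.1.1, hs.1.2.1⟩]
  have : ∀ x, ∑ y ∈ W, (b x + b y - 2 * (b x * b y)) =
      (n - 2) * b x + (gap π u v - 1) - 2 * (b x * (gap π u v - 1)) := by
    intro x
    rw [Finset.sum_sub_distrib, Finset.sum_add_distrib, ← Finset.mul_sum, ← Finset.mul_sum, hbs]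
    simp [hWc]
  have h4 : ∑ x ∈ W, ((n - 2) * b x + (gap π u v - 1) - 2 * (b x * (gap π u v - 1))) =
      2 * ((gap π u v - 1) * (n - gap π u v - 1)) := by
    rw [Finset.sum_sub_distrib, Finset.sum_add_distrib, ← Finset.mul_sum, ← Finset.mul_sum,
      ← Finset.sum_mul, hbs]
    simp only [Finset.sum_const, nsmul_eq_mul, hWc]
    ring
  rw [← h4, hW, Finset.sum_filter]
  refine Finset.sum_congr rfl fun x _ => ?_
  simp only [e]
  split_ifs
  · rw [← Finset.sum_filter, ← hW]
    exact this x
  · simp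

open Classical in
theorem sum_gap_eq_sum_separates {u v : Fin n} (h : u ≠ v) :
    n * ∑ π ∈ planarArrangements G, gap π u v =
      2 * (n - 1) * (planarArrangements G).card +
        ∑ x, ∑ y, (((planarArrangements G).filter fun π => Separates π u v x y).card : ℤ) := by
  have h1 : ∑ x, ∑ y, (((planarArrangements G).filter fun π => Separates π u v x y).card : ℤ) =
      ∑ π ∈ planarArrangements G, 2 * ((gap π u v - 1) * (n - gap π u v - 1)) := by
    simp only [← sum_separates _ h]
    symm
    rw [Finset.sum_comm]
    refine Finset.sum_congr rfl fun x _ => ?_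
    rw [Finset.sum_comm]
    refine Finset.sum_congr rfl fun y _ => ?_
    rw [Finset.card_filter]
    push_cast
    rfl
  rw [h1, sum_gap, mul_comm, ← nsmul_eq_mul, ← Finset.sum_const, ← Finset.sum_add_distrib]
  refine Finset.sum_congr rfl fun π _ => ?_
  ring

end Expectation

/-! ## The expected sum of the edge lengths -/

section Formula

variable {n : ℕ} {G : SimpleGraph (Fin n)}

open Classical in
/-- The neighbours of a vertex. -/
noncomputable def nbrs (G : SimpleGraph (Fin n)) (u : Fin n) : Finset (Fin n) :=
  Finset.univ.filter fun w => G.Adj u w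

theorem mem_nbrs {u w : Fin n} : w ∈ nbrs G u ↔ G.Adj u w := by simp [nbrs]

/-- The sum of the squares of the directional subtree sizes at `u`. -/
noncomputable def sumSq (G : SimpleGraph (Fin n)) (u : Fin n) : ℤ :=
  ∑ w ∈ nbrs G u, (dirSize G u w : ℤ) ^ 2

/-- A sum over the vertices on the side of `u` of an edge `uv`. -/
theorem sum_side (hG : G.IsTree) {u v : Fin n} (h : G.Adj u v) (f : Fin n → ℤ) :
    ∑ x ∈ (branch G v u).erase u, f x =
      ∑ w ∈ (nbrs G u).erase v, ∑ x ∈ branch G u w, f x := by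
  have h1 := sum_branch hG f h.symm (N := nbrs G u) fun w => mem_nbrs
  have h2 := Finset.add_sum_erase (branch G v u) f (mem_branch.2 (toward_of_adj hG h.symm))
  linarith

theorem mem_side (hG : G.IsTree) {u v x : Fin n} (h : G.Adj u v) :
    x ∈ (branch G v u).erase u ↔ x ≠ u ∧ toward G u x ≠ v := by
  rw [Finset.mem_erase, mem_branch, toward_eq_iff_ne hG h.symm]

theorem card_side (hG : G.IsTree) {u v : Fin n} (h : G.Adj u v) :
    (((branch G v u).erase u).card : ℤ) = dirSize G v u - 1 := by
  rw [Finset.card_erase_of_mem (mem_branch.2 (toward_of_adj hG h.symm)), ← dirSize,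
    Nat.cast_sub (dirSize_pos hG h.symm), Nat.cast_one]

open Classical in
theorem sum_separates_same_side (hG : G.IsTree) {u v : Fin n} (h : G.Adj u v) :
    3 * ∑ x ∈ (branch G v u).erase u, ∑ y ∈ (branch G v u).erase u,
        (((planarArrangements G).filter fun π => Separates π u v x y).card : ℤ) =
      (planarArrangements G).card *
        (((dirSize G v u : ℤ) - 1) ^ 2 - (sumSq G u - (dirSize G u v : ℤ) ^ 2)) := by
  set N : ℤ := ((planarArrangements G).card : ℤ) with hN
  have e : ∀ x ∈ (branch G v u).erase u, ∀ y ∈ (branch G v u).erase u,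
      3 * (((planarArrangements G).filter fun π => Separates π u v x y).card : ℤ) =
        N - N * if toward G u x = toward G u y then 1 else 0 := by
    intro x hx y hy
    rw [mem_side hG h] at hx hy
    split_ifs with hxy
    · rw [card_separates_eq_zero hG h hxy hx.2]
      simp
    · rw [mul_zero, sub_zero, hN, ← three_mul_card_separates hG h hx.1 hy.1 hxy hx.2 hy.2]
      push_cast
      rfl
  have e2 : ∑ x ∈ (branch G v u).erase u, ∑ y ∈ (branch G v u).erase u,
      (if toward G u x = toward G u y then (1 : ℤ) else 0) =
        sumSq G u - (dirSize G u v : ℤ) ^ 2 := by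
    rw [sumSq, ← Finset.add_sum_erase _ _ (mem_nbrs.2 h), add_sub_cancel_left,
      sum_side hG h]
    refine Finset.sum_congr rfl fun w hw => ?_
    have : ∀ x ∈ branch G u w, (∑ y ∈ (branch G v u).erase u,
        if toward G u x = toward G u y then (1 : ℤ) else 0) = dirSize G u w := by
      intro x hx
      rw [sum_side hG h, Finset.sum_eq_single_of_mem w hw]
      · rw [Finset.sum_congr rfl fun y hy => if_pos
          ((mem_branch.1 hx).trans (mem_branch.1 hy).symm)]
        simp [dirSize]
      · intro w' _ hww'
        refine Finset.sum_eq_zero fun y hy => if_neg ?_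
        rw [mem_branch.1 hx, mem_branch.1 hy]
        exact hww'.symm
    rw [Finset.sum_congr rfl this, Finset.sum_const, nsmul_eq_mul, dirSize, sq]
  rw [Finset.mul_sum]
  simp only [Finset.mul_sum]
  rw [Finset.sum_congr rfl fun x hx => Finset.sum_congr rfl (e x hx)]
  simp only [Finset.sum_sub_distrib, ← Finset.mul_sum]
  rw [e2]
  simp only [Finset.sum_const, nsmul_eq_mul, card_side hG h]
  ring

theorem separates_symm (π : Arrangement n) (u v x y : Fin n) :
    Separates π u v x y ↔ Separates π v u x y := by
  unfold Separates Between
  tauto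

open Classical in
theorem sum_separates_other_side (hG : G.IsTree) {u v : Fin n} (h : G.Adj u v) :
    2 * ∑ x ∈ (branch G v u).erase u, ∑ y ∈ (branch G u v).erase v,
        (((planarArrangements G).filter fun π => Separates π u v x y).card : ℤ) =
      (planarArrangements G).card * (((dirSize G v u : ℤ) - 1) * ((dirSize G u v : ℤ) - 1)) := by
  have e : ∀ x ∈ (branch G v u).erase u, ∀ y ∈ (branch G u v).erase v,
      2 * (((planarArrangements G).filter fun π => Separates π u v x y).card : ℤ) =
        (planarArrangements G).card := by
    intro x hx y hy
    rw [mem_side hG h] at hx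
    rw [mem_side hG h.symm] at hy
    rw [← two_mul_card_separates hG h hx.1 hy.1 hx.2 hy.2]
    push_cast
    rfl
  simp only [Finset.mul_sum]
  rw [Finset.sum_congr rfl fun x hx => Finset.sum_congr rfl (e x hx)]
  simp only [Finset.sum_const, nsmul_eq_mul, card_side hG h, card_side hG h.symm]
  ring

/-- The sum of the lengths of an edge in all planar arrangements. -/
theorem sum_gap_of_adj (hG : G.IsTree) {u v : Fin n} (h : G.Adj u v) :
    3 * (n * ∑ π ∈ planarArrangements G, gap π u v) =
      (planarArrangements G).card * (6 * (n - 1) +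
        (((dirSize G v u : ℤ) - 1) ^ 2 - (sumSq G u - (dirSize G u v : ℤ) ^ 2)) +
        (((dirSize G u v : ℤ) - 1) ^ 2 - (sumSq G v - (dirSize G v u : ℤ) ^ 2)) +
        3 * (((dirSize G v u : ℤ) - 1) * ((dirSize G u v : ℤ) - 1))) := by
  classical
  set q : Fin n → Fin n → ℤ := fun x y =>
    (((planarArrangements G).filter fun π => Separates π u v x y).card : ℤ) with hq
  have hz : ∀ x y, (x = u ∨ x = v) ∨ (y = u ∨ y = v) → q x y = 0 := by
    intro x y hxy
    rw [hq]
    simp only [Nat.cast_eq_zero, Finset.card_eq_zero]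
    refine Finset.filter_false_of_mem fun π _ hs => ?_
    have := hs.1
    tauto
  have hsplit : ∀ f : Fin n → ℤ, f u = 0 → f v = 0 → ∑ x, f x =
      ∑ x ∈ (branch G v u).erase u, f x + ∑ x ∈ (branch G u v).erase v, f x := by
    intro f hu hv
    rw [Finset.sum_erase _ hu, Finset.sum_erase _ hv]
    have : branch G v u = Finset.univ.filter fun x => ¬ toward G u x = v := by
      ext x; simp [branch, toward_eq_iff_ne hG h]
    rw [this, branch, add_comm, Finset.sum_filter_add_sum_filter_not]
  have hsum : ∑ x, ∑ y, q x y =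
      (∑ x ∈ (branch G v u).erase u, ∑ y ∈ (branch G v u).erase u, q x y +
        ∑ x ∈ (branch G v u).erase u, ∑ y ∈ (branch G u v).erase v, q x y) +
      (∑ x ∈ (branch G u v).erase v, ∑ y ∈ (branch G v u).erase u, q x y +
        ∑ x ∈ (branch G u v).erase v, ∑ y ∈ (branch G u v).erase v, q x y) := by
    rw [hsplit (fun x => ∑ y, q x y)
      (Finset.sum_eq_zero fun y _ => hz _ _ (.inl (.inl rfl)))
      (Finset.sum_eq_zero fun y _ => hz _ _ (.inl (.inr rfl))),
      ← Finset.sum_add_distrib, ← Finset.sum_add_distrib]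
    congr 1 <;>
    exact Finset.sum_congr rfl fun x _ =>
      hsplit (q x) (hz _ _ (.inr (.inl rfl))) (hz _ _ (.inr (.inr rfl)))
  have hs : ∀ x y, q x y =
      (((planarArrangements G).filter fun π => Separates π v u x y).card : ℤ) := by
    intro x y
    simp only [hq, separates_symm _ u v]
  have h1 := sum_separates_same_side hG h
  have h2 := sum_separates_same_side hG h.symm
  have h3 := sum_separates_other_side hG h
  have h4 := sum_separates_other_side hG h.symm
  simp only [← hs] at h2 h4
  have h5 := sum_gap_eq_sum_separates (G := G) h.ne
  change 3 * ∑ x ∈ _, ∑ y ∈ _, q x y = _ at h1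
  change 2 * ∑ x ∈ _, ∑ y ∈ _, q x y = _ at h3
  change _ = _ + ∑ x, ∑ y, q x y at h5
  rw [hsum] at h5
  apply mul_left_cancel₀ (two_ne_zero (α := ℤ))
  linear_combination 6 * h5 + 2 * h1 + 2 * h2 + 3 * h3 + 3 * h4

theorem toward_eq_of_adj_root (hG : G.IsTree) {r a b : Fin n} (h : G.Adj a b) :
    toward G a r = b ∨ toward G b r = a := by
  have := toward_eq_iff_ne hG h r
  tauto

/-- A sum over the ordered pairs of adjacent vertices, arranged by means of a root. -/
theorem sum_nbrs_eq (hG : G.IsTree) {M : Type*} [AddCommMonoid M] (r : Fin n)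
    (f : Fin n → Fin n → M) :
    ∑ u, ∑ w ∈ nbrs G u, f u w =
      ∑ x ∈ Finset.univ.erase r, (f x (toward G x r) + f (toward G x r) x) := by
  classical
  have h1 : ∀ u w, (if G.Adj u w then f u w else 0) =
      (if u ≠ r ∧ w = toward G u r then f u w else 0) +
        (if w ≠ r ∧ u = toward G w r then f u w else 0) := by
    intro u w
    have a1 : ∀ u w, (u ≠ r ∧ w = toward G u r) ↔ G.Adj u w ∧ toward G u r = w := by
      intro u w
      constructor
      · rintro ⟨h, rfl⟩
        exact ⟨adj_toward hG (Ne.symm h), rfl⟩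
      · rintro ⟨h, rfl⟩
        refine ⟨?_, rfl⟩
        rintro rfl
        rw [toward_self hG] at h
        exact h.ne rfl
    rw [if_congr (a1 u w) rfl rfl, if_congr (a1 w u) rfl rfl]
    by_cases h : G.Adj u w
    · have := toward_eq_iff_ne hG h r
      by_cases h2 : toward G u r = w
      · rw [if_pos h, if_pos ⟨h, h2⟩, if_neg fun h3 => this.1 h2 h3.2, add_zero]
      · rw [if_pos h, if_neg fun h3 => h2 h3.2, if_pos ⟨h.symm, by tauto⟩, zero_add]
    · rw [if_neg h, if_neg fun h3 => h h3.1, if_neg fun h3 => h h3.1.symm, add_zero]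
  have h2 : ∀ g : Fin n → Fin n → M,
      ∑ u, ∑ w, (if u ≠ r ∧ w = toward G u r then g u w else 0) =
        ∑ x ∈ Finset.univ.erase r, g x (toward G x r) := by
    intro g
    refine (Finset.sum_erase (a := r) _ ?_).symm.trans ?_
    · exact Finset.sum_eq_zero fun w _ => if_neg fun h => h.1 rfl
    · refine Finset.sum_congr rfl fun x hx => ?_
      rw [Finset.sum_eq_single_of_mem (toward G x r) (Finset.mem_univ _)]
      · rw [if_pos ⟨Finset.ne_of_mem_erase hx, rfl⟩]
      · intro w _ hw
        exact if_neg fun h => hw h.2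
  simp only [nbrs, Finset.sum_filter, h1, Finset.sum_add_distrib]
  rw [h2, Finset.sum_comm, h2 fun w u => f u w]

open Classical in
theorem sum_edgeFinset_eq (hG : G.IsTree) {M : Type*} [AddCommMonoid M] (r : Fin n)
    (f : Sym2 (Fin n) → M) :
    ∑ e ∈ G.edgeFinset, f e = ∑ x ∈ Finset.univ.erase r, f s(x, toward G x r) := by
  symm
  refine Finset.sum_bij (fun x _ => s(x, toward G x r)) ?_ ?_ ?_ fun _ _ => rfl
  · intro x hx
    rw [SimpleGraph.mem_edgeFinset, SimpleGraph.mem_edgeSet]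
    exact adj_toward hG (Finset.ne_of_mem_erase hx).symm
  · intro x hx y hy h
    rw [Sym2.eq_iff] at h
    rcases h with h | ⟨h1, h2⟩
    · exact h.1
    · have hadj := adj_toward hG (Finset.ne_of_mem_erase hx).symm
      rw [h2] at hadj
      exact absurd h1.symm ((toward_eq_iff_ne hG hadj r).1 h2)
  · intro e
    induction e with
    | h a b =>
      intro he
      rw [SimpleGraph.mem_edgeFinset, SimpleGraph.mem_edgeSet] at he
      have key : ∀ a b, G.Adj a b → toward G a r = b → a ≠ r := by
        rintro a b h rfl rfl
        rw [toward_self hG] at h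
        exact h.ne rfl
      rcases toward_eq_of_adj_root hG (r := r) he with h | h
      · exact ⟨a, Finset.mem_erase.2 ⟨key _ _ he h, Finset.mem_univ _⟩, by rw [h]⟩
      · exact ⟨b, Finset.mem_erase.2 ⟨key _ _ he.symm h, Finset.mem_univ _⟩, by
          rw [h, Sym2.eq_swap]⟩

theorem two_mul_sum_sumEdgeLengths (hG : G.IsTree) (r : Fin n) :
    2 * ∑ π ∈ planarArrangements G, sumEdgeLengths G π =
      ∑ u, ∑ w ∈ nbrs G u, ∑ π ∈ planarArrangements G, gap π u w := by
  have hl : ∀ (π : Arrangement n) u w, edgeLength π s(u, w) = gap π u w := fun _ _ _ => rfl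
  have hc : ∀ (π : Arrangement n) u w, gap π u w = gap π w u := fun _ _ _ => abs_sub_comm _ _
  rw [sum_nbrs_eq hG r]
  simp only [sumEdgeLengths, sum_edgeFinset_eq hG r, hl]
  rw [Finset.sum_comm, Finset.mul_sum]
  refine Finset.sum_congr rfl fun x _ => ?_
  rw [two_mul]
  congr 1
  exact Finset.sum_congr rfl fun π _ => hc _ _ _

theorem sum_nbrs_comm {M : Type*} [AddCommMonoid M] (f : Fin n → Fin n → M) :
    ∑ u, ∑ w ∈ nbrs G u, f u w = ∑ u, ∑ w ∈ nbrs G u, f w u :=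
  Finset.sum_comm' fun x y => by simp [mem_nbrs, G.adj_comm]

theorem sum_card_nbrs (hG : G.IsTree) (r : Fin n) :
    ∑ u : Fin n, ((nbrs G u).card : ℤ) = 2 * (n - 1) := by
  have hn : 1 ≤ n := by have := r.2; omega
  have := sum_nbrs_eq hG r fun _ _ => (1 : ℤ)
  simp only [Finset.sum_const, nsmul_eq_mul, mul_one] at this
  rw [this, Finset.card_erase_of_mem (Finset.mem_univ _), Finset.card_univ, Fintype.card_fin,
    Nat.cast_sub hn]
  push_cast
  ring

theorem six_mul_sum_sumEdgeLengths (hG : G.IsTree) (r : Fin n) :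
    6 * n * ∑ π ∈ planarArrangements G, sumEdgeLengths G π =
      (planarArrangements G).card *
        ((n - 1) * (3 * n ^ 2 + 2 * n - 2) -
          ∑ u, (2 * ((nbrs G u).card : ℤ) - 1) * sumSq G u) := by
  have hn : 1 ≤ n := by have := r.2; omega
  set N : ℤ := ((planarArrangements G).card : ℤ)
  have h1 := two_mul_sum_sumEdgeLengths hG r
  have hd : ∀ u, ∑ w ∈ nbrs G u, (dirSize G u w : ℤ) = n - 1 := by
    intro u
    have := sum_dirSize hG u (N := nbrs G u) fun w => mem_nbrs
    rw [Fintype.card_fin] at this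
    rw [← Nat.cast_sum, this, Nat.cast_sub hn, Nat.cast_one]
  have hsq : ∀ u, ∑ w ∈ nbrs G u, (dirSize G u w : ℤ) ^ 2 = sumSq G u := fun _ => rfl
  have hcard := sum_card_nbrs hG r
  have key : ∀ u, ∀ w ∈ nbrs G u, 3 * (n * ∑ π ∈ planarArrangements G, gap π u w) =
      N * (2 * n ^ 2 + n - 1) - N * n * dirSize G u w + N * (dirSize G u w : ℤ) ^ 2 -
        N * sumSq G u - N * sumSq G w := by
    intro u w hw
    rw [mem_nbrs] at hw
    have h2 : (dirSize G u w : ℤ) + dirSize G w u = n := by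
      exact_mod_cast Fintype.card_fin n ▸ dirSize_add_dirSize hG hw
    rw [sum_gap_of_adj hG hw, eq_sub_of_add_eq' h2]
    ring
  have h3 : ∑ u, ∑ w ∈ nbrs G u, 3 * (n * ∑ π ∈ planarArrangements G, gap π u w) =
      N * (2 * n ^ 2 + n - 1) * (2 * (n - 1)) - N * n * (n * (n - 1)) +
        N * ∑ u, sumSq G u - 2 * (N * ∑ u, ((nbrs G u).card : ℤ) * sumSq G u) := by
    rw [Finset.sum_congr rfl fun u _ => Finset.sum_congr rfl (key u)]
    simp only [Finset.sum_sub_distrib, Finset.sum_add_distrib]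
    rw [sum_nbrs_comm fun u w => N * sumSq G w]
    simp only [← Finset.mul_sum, Finset.sum_const, hd, hsq, nsmul_eq_mul]
    rw [← Finset.sum_mul, hcard]
    simp only [Finset.card_univ, Fintype.card_fin]
    ring
  have h4 : ∑ u, (2 * ((nbrs G u).card : ℤ) - 1) * sumSq G u =
      2 * ∑ u, ((nbrs G u).card : ℤ) * sumSq G u - ∑ u, sumSq G u := by
    rw [Finset.mul_sum, ← Finset.sum_sub_distrib]
    exact Finset.sum_congr rfl fun u _ => by ring
  simp only [← Finset.mul_sum, ← h1] at h3
  rw [h4]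
  linear_combination h3

/-- A tree has a planar arrangement. -/
theorem planarArrangements_nonempty (hG : G.IsTree) (r : Fin n) :
    (planarArrangements G).Nonempty := by
  have key : ∀ k, 1 ≤ k → k ≤ n → ∃ (S : Finset (Fin n)) (f : Fin n → ℕ), S.card = k ∧ r ∈ S ∧
      (∀ z ∈ S, z ≠ r → toward G z r ∈ S) ∧ Set.InjOn f S ∧
      ∀ a ∈ S, ∀ c ∈ S, ∀ b ∈ S, ∀ d ∈ S, G.Adj a c → G.Adj b d →
        ¬ (f a < f b ∧ f b < f c ∧ f c < f d) := by
    intro k hk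
    induction k, hk using Nat.le_induction with
    | base =>
      intro _
      refine ⟨{r}, fun _ => 0, by simp, by simp, ?_, by simp, by simp⟩
      intro z hz h
      exact absurd (Finset.mem_singleton.1 hz) h
    | succ k hk ih =>
      intro hkn
      obtain ⟨S, f, hS, hr, hcl, hinj, hpl⟩ := ih (by omega)
      obtain ⟨y, x, hyx, hy, hx⟩ : ∃ y x, G.Adj y x ∧ y ∈ S ∧ x ∉ S := by
        by_contra hno
        push Not at hno
        have hall : ∀ x, x ∈ S := forall_of_connected hG.1 hr hno
        rw [Finset.eq_univ_of_forall hall, Finset.card_univ, Fintype.card_fin] at hS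
        omega
      have honly : ∀ z ∈ S, G.Adj z x → z = y := by
        have hpar : ∀ z ∈ S, G.Adj z x → toward G x r = z := by
          intro z hz hzx
          rcases toward_eq_of_adj_root hG (r := r) hzx with h | h
          · exfalso
            by_cases hzr : z = r
            · rw [hzr, toward_self hG] at h
              exact hx (h ▸ hr)
            · exact hx (h ▸ hcl z hz hzr)
          · exact h
        intro z hz hzx
        rw [← hpar z hz hzx, hpar y hy hyx]
      have hxr : x ≠ r := by rintro rfl; exact hx hr
      have hpx : toward G x r = y := by
        rcases toward_eq_of_adj_root hG (r := r) hyx with h | h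
        · exfalso
          by_cases hyr : y = r
          · rw [hyr, toward_self hG] at h
            exact hxr h.symm
          · exact hx (h ▸ hcl y hy hyr)
        · exact h
      set g : Fin n → ℕ := fun z => if z = x then 2 * f y + 1 else 2 * f z with hg
      have gx : g x = 2 * f y + 1 := by simp [hg]
      have gS : ∀ z ∈ S, g z = 2 * f z := by
        intro z hz
        have : z ≠ x := by rintro rfl; exact hx hz
        simp [hg, this]
      refine ⟨insert x S, g, by rw [Finset.card_insert_of_notMem hx, hS],
        Finset.mem_insert_of_mem hr, ?_, ?_, ?_⟩
      · intro z hz hzr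
        rcases Finset.mem_insert.1 hz with rfl | hz
        · rw [hpx]; exact Finset.mem_insert_of_mem hy
        · exact Finset.mem_insert_of_mem (hcl z hz hzr)
      · intro a ha b hb hab
        rcases Finset.mem_insert.1 (Finset.mem_coe.1 ha) with rfl | ha' <;>
          rcases Finset.mem_insert.1 (Finset.mem_coe.1 hb) with rfl | hb'
        · rfl
        · rw [gx, gS _ hb'] at hab; omega
        · rw [gx, gS _ ha'] at hab; omega
        · rw [gS _ ha', gS _ hb'] at hab
          exact hinj ha' hb' (by omega)
      · have hnx : ∀ a c, a ∈ insert x S → c ∈ insert x S → G.Adj a c →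
            (a ∈ S ∧ c ∈ S) ∨ (a = x ∧ c = y) ∨ (a = y ∧ c = x) := by
          intro a c ha hc hac
          rcases Finset.mem_insert.1 ha with rfl | ha' <;>
            rcases Finset.mem_insert.1 hc with rfl | hc'
          · exact absurd rfl hac.ne
          · exact .inr (.inl ⟨rfl, honly c hc' hac.symm⟩)
          · exact .inr (.inr ⟨honly a ha' hac, rfl⟩)
          · exact .inl ⟨ha', hc'⟩
        have hval : ∀ a ∈ insert x S, g a = 2 * f y + 1 ∨ ∃ m, g a = 2 * m := by
          intro a ha
          rcases Finset.mem_insert.1 ha with rfl | ha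
          · exact .inl gx
          · exact .inr ⟨_, gS _ ha⟩
        have gy := gS y hy
        intro a ha c hc b hb d hd hac hbd
        have va := hval a ha
        have vb := hval b hb
        have vc := hval c hc
        have vd := hval d hd
        rcases hnx a c ha hc hac with ⟨ha', hc'⟩ | ⟨rfl, rfl⟩ | ⟨rfl, rfl⟩ <;>
          rcases hnx b d hb hd hbd with ⟨hb', hd'⟩ | ⟨rfl, rfl⟩ | ⟨rfl, rfl⟩
        · have := hpl a ha' c hc' b hb' d hd' hac hbd
          rw [gS _ ha', gS _ hb', gS _ hc', gS _ hd']
          omega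
        all_goals omega
  obtain ⟨S, f, hS, -, -, hinj, hpl⟩ := key n (by have := r.2; omega) le_rfl
  have hall : ∀ x, x ∈ S := by
    have : S = Finset.univ := Finset.eq_univ_of_card S (by rw [hS, Fintype.card_fin])
    simp [this]
  obtain ⟨π, hπ⟩ := exists_perm_lt_iff f fun a b h => hinj (hall a) (hall b) h
  refine ⟨π, mem_planarArrangements.2 fun a c b d hac hbd => ?_⟩
  rw [hπ, hπ, hπ]
  exact hpl a (hall a) c (hall c) b (hall b) d (hall d) hac hbd

/-- The expected sum of the edge lengths in terms of the directional subtree sizes. -/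
theorem expectedPlanar_eq (hG : G.IsTree) (r : Fin n) :
    expectedPlanar G =
      (((n - 1) * (3 * n ^ 2 + 2 * n - 2) -
        ∑ u, (2 * ((nbrs G u).card : ℤ) - 1) * sumSq G u : ℤ) : ℚ) / ((6 * n : ℤ) : ℚ) := by
  have hn : n ≠ 0 := by have := r.2; omega
  have h1 : ((planarArrangements G).card : ℚ) ≠ 0 :=
    Nat.cast_ne_zero.2 (Finset.card_pos.2 (planarArrangements_nonempty hG r)).ne'
  have h2 : ((6 * n : ℤ) : ℚ) ≠ 0 := by
    push_cast
    positivity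
  rw [expectedPlanar, div_eq_div_iff h1 h2, ← Int.cast_sum, mul_comm, ← Int.cast_mul,
    six_mul_sum_sumEdgeLengths hG r, Int.cast_mul, Int.cast_natCast, mul_comm]

end Formula

/-! ## Reasoning about computations -/

section Machine

/-- All words in memory are at most `M` in absolute value. -/
def Config.BoundedBy (M : ℤ) (c : Config) : Prop := ∀ w ∈ c.words, |w| ≤ M

theorem Config.boundedBy_iff {M : ℤ} {c : Config} : c.BoundedBy M ↔
    (∀ w ∈ c.loc, |w| ≤ M) ∧ (∀ act ∈ c.stack, ∀ w ∈ act.loc, |w| ≤ M) ∧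
      ∀ l ∈ c.heap, ∀ w ∈ l, |w| ≤ M := by
  simp only [Config.BoundedBy, Config.words, List.mem_append, List.mem_flatMap, List.mem_flatten]
  constructor
  · intro h
    exact ⟨fun w hw => h w (.inl (.inl hw)), fun a ha w hw => h w (.inl (.inr ⟨a, ha, hw⟩)),
      fun l hl w hw => h w (.inr ⟨l, hl, hw⟩)⟩
  · rintro ⟨h1, h2, h3⟩ w ((hw | ⟨a, ha, hw⟩) | ⟨l, hl, hw⟩)
    · exact h1 w hw
    · exact h2 a ha w hw
    · exact h3 l hl w hw

/-- One step of a computation that writes no word of absolute value over `M`, and in which the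
space grows by at most `20` times the time. -/
structure GoodStep (P : Program) {n : ℕ} (A : AdjLists n) (M : ℤ) (c c' : Config) : Prop where
  step_eq : step P A c = some c'
  bounded : c.BoundedBy M → c'.BoundedBy M
  clock_le : c.clock ≤ c'.clock
  space_le : c'.space A + 20 * c.clock ≤ c.space A + 20 * c'.clock

/-- A configuration without its clock. -/
structure State : Type where
  code : List Stmt
  loc : List ℤ
  stack : List Act
  heap : List (List ℤ)

/-- The configuration with the given clock. -/
def State.at (s : State) (t : ℕ) : Config := ⟨s.code, s.loc, s.stack, s.heap, t⟩

/-- The computation leads from `s` to `s'` in at most `b` units of time. -/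
def Steps (P : Program) {n : ℕ} (A : AdjLists n) (M : ℤ) (b : ℕ) (s s' : State) : Prop :=
  ∀ t, ∃ t', t' ≤ t + b ∧ Relation.ReflTransGen (GoodStep P A M) (s.at t) (s'.at t')

variable {P : Program} {n : ℕ} {A : AdjLists n} {M : ℤ}

theorem Steps.refl (s : State) : Steps P A M 0 s s := fun t => ⟨t, le_rfl, .refl⟩

theorem Steps.trans {b b' : ℕ} {s s' s'' : State} (h : Steps P A M b s s')
    (h' : Steps P A M b' s' s'') : Steps P A M (b + b') s s'' := by
  intro t
  obtain ⟨t', ht', hr⟩ := h t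
  obtain ⟨t'', ht'', hr'⟩ := h' t'
  exact ⟨t'', by omega, hr.trans hr'⟩

theorem Steps.mono {b b' : ℕ} {s s' : State} (h : Steps P A M b s s') (hb : b ≤ b') :
    Steps P A M b' s s' := by
  intro t
  obtain ⟨t', ht', hr⟩ := h t
  exact ⟨t', by omega, hr⟩

theorem Steps.head {b k : ℕ} {s s' s'' : State}
    (h : ∀ t, GoodStep P A M (s.at t) (s'.at (t + k))) (hk : k ≤ b)
    (h' : Steps P A M (b - k) s' s'') : Steps P A M b s s'' := by
  intro t
  obtain ⟨t', ht', hr⟩ := h' (t + k)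
  exact ⟨t', by omega, .head (h t) hr⟩

theorem Steps.assign {b x : ℕ} {e : Exp} {rest : List Stmt} {loc : List ℤ} {st : List Act}
    {heap : List (List ℤ)} {s' : State} (z : ℤ) (hz : e.eval A loc heap = some z)
    (hx : x < loc.length) (hM : |z| ≤ M) (hb : 1 + e.cost ≤ b)
    (h : Steps P A M (b - (1 + e.cost)) ⟨rest, loc.set x z, st, heap⟩ s') :
    Steps P A M b ⟨.assign x e :: rest, loc, st, heap⟩ s' := by
  refine Steps.head (fun t => ⟨?_, ?_, ?_, ?_⟩) hb h
  · simp [step, State.at, hz, hx, Nat.add_assoc]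
  · simp only [Config.boundedBy_iff, State.at]
    rintro ⟨h1, h2⟩
    refine ⟨fun w hw => ?_, h2⟩
    rcases List.mem_or_eq_of_mem_set hw with hw | rfl
    · exact h1 w hw
    · exact hM
  · simp [State.at]
  · simp only [State.at, Config.space, Config.words, List.length_append, List.length_set,
      List.length_cons]
    omega

theorem length_flatten_set {heap : List (List ℤ)} {a : ℕ} {l l' : List ℤ}
    (h : heap[a]? = some l) :
    (heap.set a l').flatten.length + l.length = heap.flatten.length + l'.length := by
  induction heap generalizing a with
  | nil => simp at h
  | cons x xs ih =>
    cases a with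
    | zero =>
      simp only [List.getElem?_cons_zero, Option.some.injEq] at h
      subst h
      simp only [List.set_cons_zero, List.flatten_cons, List.length_append]
      omega
    | succ a =>
      have := ih (by simpa using h)
      simp only [List.set_cons_succ, List.flatten_cons, List.length_append]
      omega

theorem length_of_writeAt {l l' : List ℤ} {j z : ℤ} (h : writeAt l j z = some l') :
    l'.length = l.length := by
  unfold writeAt at h
  split_ifs at h
  cases h
  simp

theorem mem_of_writeAt {l l' : List ℤ} {j z w : ℤ} (h : writeAt l j z = some l') (hw : w ∈ l') :
    w ∈ l ∨ w = z := by
  unfold writeAt at h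
  split_ifs at h
  cases h
  exact List.mem_or_eq_of_mem_set hw

theorem Steps.store {b a : ℕ} {i e : Exp} {rest : List Stmt} {loc : List ℤ} {st : List Act}
    {heap : List (List ℤ)} {s' : State} (j z : ℤ) (l l' : List ℤ)
    (hj : i.eval A loc heap = some j) (hz : e.eval A loc heap = some z)
    (hl : heap[a]? = some l) (hl' : writeAt l j z = some l') (hM : |z| ≤ M)
    (hb : 1 + i.cost + e.cost ≤ b)
    (h : Steps P A M (b - (1 + i.cost + e.cost)) ⟨rest, loc, st, heap.set a l'⟩ s') :
    Steps P A M b ⟨.store a i e :: rest, loc, st, heap⟩ s' := by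
  refine Steps.head (fun t => ⟨?_, ?_, ?_, ?_⟩) hb h
  · simp [step, State.at, hj, hz, hl, hl', Nat.add_assoc]
  · simp only [Config.boundedBy_iff, State.at]
    rintro ⟨h1, h2, h3⟩
    refine ⟨h1, h2, fun m hm w hw => ?_⟩
    rcases List.mem_or_eq_of_mem_set hm with hm | rfl
    · exact h3 m hm w hw
    · rcases mem_of_writeAt hl' hw with hw | rfl
      · exact h3 l (List.mem_of_getElem? hl) w hw
      · exact hM
  · simp [State.at]
  · have h1 := length_flatten_set (l' := l') hl
    have h2 := length_of_writeAt hl'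
    simp only [State.at, Config.space, Config.words, List.length_append, List.length_cons]
    omega

theorem Steps.alloc {b a : ℕ} {e : Exp} {rest : List Stmt} {loc : List ℤ} {st : List Act}
    {heap : List (List ℤ)} {s' : State} (k : ℕ) (hk : e.eval A loc heap = some (k : ℤ))
    (ha : a < heap.length) (hM : 0 ≤ M) (hb : 1 + e.cost + k ≤ b)
    (h : Steps P A M (b - (1 + e.cost + k)) ⟨rest, loc, st, heap.set a (List.replicate k 0)⟩ s') :
    Steps P A M b ⟨.alloc a e :: rest, loc, st, heap⟩ s' := by
  refine Steps.head (fun t => ⟨?_, ?_, ?_, ?_⟩) hb h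
  · simp [step, State.at, hk, ha, Nat.add_assoc]
  · simp only [Config.boundedBy_iff, State.at]
    rintro ⟨h1, h2, h3⟩
    refine ⟨h1, h2, fun m hm w hw => ?_⟩
    rcases List.mem_or_eq_of_mem_set hm with hm | rfl
    · exact h3 m hm w hw
    · rw [List.eq_of_mem_replicate hw, abs_zero]
      exact hM
  · simp [State.at]
  · have h1 := length_flatten_set (l' := List.replicate k 0) (List.getElem?_eq_getElem ha)
    rw [List.length_replicate] at h1
    simp only [State.at, Config.space, Config.words, List.length_append, List.length_cons]
    omega

theorem Steps.cond_true {b : ℕ} {c : Test} {body rest : List Stmt} {loc : List ℤ} {st : List Act}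
    {heap : List (List ℤ)} {s' : State} (hc : c.eval A loc heap = some true)
    (hbody : body.length ≤ 20) (hb : 1 + c.cost ≤ b)
    (h : Steps P A M (b - (1 + c.cost)) ⟨body ++ rest, loc, st, heap⟩ s') :
    Steps P A M b ⟨.cond c body :: rest, loc, st, heap⟩ s' := by
  refine Steps.head (fun t => ⟨?_, ?_, ?_, ?_⟩) hb h
  · simp [step, State.at, hc, Nat.add_assoc]
  · simp only [Config.boundedBy_iff, State.at, imp_self]
  · simp [State.at]
  · simp only [State.at, Config.space, Config.words, List.length_append, List.length_cons]
    omega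

theorem Steps.cond_false {b : ℕ} {c : Test} {body rest : List Stmt} {loc : List ℤ} {st : List Act}
    {heap : List (List ℤ)} {s' : State} (hc : c.eval A loc heap = some false)
    (hb : 1 + c.cost ≤ b)
    (h : Steps P A M (b - (1 + c.cost)) ⟨rest, loc, st, heap⟩ s') :
    Steps P A M b ⟨.cond c body :: rest, loc, st, heap⟩ s' := by
  refine Steps.head (fun t => ⟨?_, ?_, ?_, ?_⟩) hb h
  · simp [step, State.at, hc, Nat.add_assoc]
  · simp only [Config.boundedBy_iff, State.at, imp_self]
  · simp [State.at]
  · simp only [State.at, Config.space, Config.words, List.length_append, List.length_cons]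
    omega

theorem Steps.loop_true {b : ℕ} {c : Test} {body rest : List Stmt} {loc : List ℤ} {st : List Act}
    {heap : List (List ℤ)} {s' : State} (hc : c.eval A loc heap = some true)
    (hbody : body.length ≤ 20) (hb : 1 + c.cost ≤ b)
    (h : Steps P A M (b - (1 + c.cost)) ⟨body ++ .loop c body :: rest, loc, st, heap⟩ s') :
    Steps P A M b ⟨.loop c body :: rest, loc, st, heap⟩ s' := by
  refine Steps.head (fun t => ⟨?_, ?_, ?_, ?_⟩) hb h
  · simp [step, State.at, hc, Nat.add_assoc]
  · simp only [Config.boundedBy_iff, State.at, imp_self]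
  · simp [State.at]
  · simp only [State.at, Config.space, Config.words, List.length_append, List.length_cons]
    omega

theorem Steps.loop_false {b : ℕ} {c : Test} {body rest : List Stmt} {loc : List ℤ} {st : List Act}
    {heap : List (List ℤ)} {s' : State} (hc : c.eval A loc heap = some false)
    (hb : 1 + c.cost ≤ b)
    (h : Steps P A M (b - (1 + c.cost)) ⟨rest, loc, st, heap⟩ s') :
    Steps P A M b ⟨.loop c body :: rest, loc, st, heap⟩ s' := by
  refine Steps.head (fun t => ⟨?_, ?_, ?_, ?_⟩) hb h
  · simp [step, State.at, hc, Nat.add_assoc]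
  · simp only [Config.boundedBy_iff, State.at, imp_self]
  · simp [State.at]
  · simp only [State.at, Config.space, Config.words, List.length_append, List.length_cons]
    omega

theorem Steps.call {b x p : ℕ} {args : List Exp} {rest : List Stmt} {loc : List ℤ}
    {st : List Act} {heap : List (List ℤ)} {s' : State} (q : Proc) (zs : List ℤ)
    (hq : P.procs[p]? = some q) (hzs : evalArgs A loc heap args = some zs)
    (hl : zs.length ≤ q.locals) (hbody : q.body.length ≤ 20) (hM : ∀ z ∈ zs, |z| ≤ M)
    (hM0 : 0 ≤ M) (hb : 1 + (args.map Exp.cost).sum + q.locals ≤ b)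
    (h : Steps P A M (b - (1 + (args.map Exp.cost).sum + q.locals))
      ⟨q.body, zs ++ List.replicate (q.locals - zs.length) 0, ⟨rest, loc, x⟩ :: st, heap⟩ s') :
    Steps P A M b ⟨.call x p args :: rest, loc, st, heap⟩ s' := by
  refine Steps.head (fun t => ⟨?_, ?_, ?_, ?_⟩) hb h
  · simp [step, State.at, hq, hzs, hl, Nat.add_assoc]
  · simp only [Config.boundedBy_iff, State.at]
    rintro ⟨h1, h2, h3⟩
    refine ⟨fun w hw => ?_, fun act hact => ?_, h3⟩
    · rcases List.mem_append.1 hw with hw | hw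
      · exact hM w hw
      · rw [List.eq_of_mem_replicate hw, abs_zero]
        exact hM0
    · rcases List.mem_cons.1 hact with rfl | hact
      · exact h1
      · exact h2 act hact
  · simp [State.at, Nat.add_assoc]
  · simp only [State.at, Config.space, Config.words, List.length_append, List.length_cons,
      List.flatMap_cons, List.map_cons, List.sum_cons, List.length_replicate]
    omega

theorem Steps.ret {b : ℕ} {e : Exp} {rest : List Stmt} {loc : List ℤ} {act : Act}
    {st : List Act} {heap : List (List ℤ)} {s' : State} (z : ℤ)
    (hz : e.eval A loc heap = some z) (hd : act.dest < act.loc.length) (hM : |z| ≤ M)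
    (hb : 1 + e.cost ≤ b)
    (h : Steps P A M (b - (1 + e.cost)) ⟨act.code, act.loc.set act.dest z, st, heap⟩ s') :
    Steps P A M b ⟨.ret e :: rest, loc, act :: st, heap⟩ s' := by
  refine Steps.head (fun t => ⟨?_, ?_, ?_, ?_⟩) hb h
  · simp [step, State.at, hz, hd, Nat.add_assoc]
  · simp only [Config.boundedBy_iff, State.at]
    rintro ⟨-, h2, h3⟩
    refine ⟨fun w hw => ?_, fun a ha => h2 a (List.mem_cons_of_mem _ ha), h3⟩
    rcases List.mem_or_eq_of_mem_set hw with hw | rfl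
    · exact h2 act List.mem_cons_self w hw
    · exact hM
  · simp [State.at]
  · simp only [State.at, Config.space, Config.words, List.length_append, List.length_cons,
      List.flatMap_cons, List.map_cons, List.sum_cons, List.length_set]
    omega

theorem exists_run {c : Config} (hM : 0 ≤ M)
    (h : Relation.ReflTransGen (GoodStep P A M) P.init c) :
    ∃ k, P.run A k = some c ∧ ∀ j ≤ k, ∃ d, P.run A j = some d ∧ d.BoundedBy M ∧
      d.clock ≤ c.clock ∧ d.space A ≤ P.init.space A + 20 * c.clock := by
  have key : ∃ k, P.run A k = some c ∧ c.BoundedBy M ∧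
      c.space A ≤ P.init.space A + 20 * c.clock ∧ ∀ j ≤ k, ∃ d, P.run A j = some d ∧
        d.BoundedBy M ∧ d.clock ≤ c.clock ∧ d.space A ≤ P.init.space A + 20 * c.clock := by
    induction h with
    | refl =>
      have hb : P.init.BoundedBy M := by
        rw [Config.boundedBy_iff]
        refine ⟨fun w hw => ?_, fun act hact => ?_, fun l hl w hw => ?_⟩
        · rw [List.eq_of_mem_replicate hw, abs_zero]; exact hM
        · simp [Program.init] at hact
        · rw [List.eq_of_mem_replicate hl] at hw; simp at hw
      refine ⟨0, rfl, hb, by omega, fun j hj => ?_⟩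
      obtain rfl : j = 0 := by omega
      exact ⟨_, rfl, hb, le_rfl, by omega⟩
    | @tail b c _ hs ih =>
      obtain ⟨k, hk, hb, hsp, hj⟩ := ih
      have hrun : P.run A (k + 1) = some c := by
        rw [Program.run, hk]; exact hs.step_eq
      have h1 := hs.clock_le
      have h2 := hs.space_le
      refine ⟨k + 1, hrun, hs.bounded hb, by omega, fun j hjk => ?_⟩
      rcases Nat.lt_or_ge k j with h3 | h3
      · obtain rfl : j = k + 1 := by omega
        exact ⟨_, hrun, hs.bounded hb, le_rfl, by omega⟩
      · obtain ⟨d, d1, d2, d3, d4⟩ := hj j h3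
        exact ⟨d, d1, d2, by omega, by omega⟩
  obtain ⟨k, hk, -, -, h2⟩ := key
  exact ⟨k, hk, h2⟩

end Machine

/-! ## The computation of the directional subtree sizes -/

section Sizes

/-- An array of length `N` that starts with `l`. -/
def pad (N : ℕ) (l : List ℤ) : List ℤ := l ++ List.replicate (N - l.length) 0

theorem writeAt_pad {N : ℕ} {l : List ℤ} (h : l.length < N) {j : ℤ} (hj : j = l.length) (z : ℤ) :
    writeAt (pad N l) j z = some (pad N (l ++ [z])) := by
  obtain ⟨m, hm⟩ : ∃ m, N - l.length = m + 1 := ⟨N - l.length - 1, by omega⟩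
  have hm' : N - (l ++ [z]).length = m := by
    rw [List.length_append, List.length_singleton]; omega
  subst hj
  rw [writeAt, if_pos ⟨by omega, by simp [pad]; omega⟩, pad, pad, hm, hm', List.replicate_succ]
  simp

theorem readAt_pad {N : ℕ} {l : List ℤ} {i : ℕ} (h : i < l.length) :
    readAt (pad N l) (i : ℤ) = some l[i] := by
  simp [readAt, pad, List.getElem?_append_left, h]

variable {n : ℕ}

theorem degAt_coe (A : AdjLists n) (v : Fin n) :
    degAt A ((v : ℕ) : ℤ) = some ((A v).length : ℤ) := by
  simp [degAt]

theorem nbrAt_coe {A : AdjLists n} {v w : Fin n} {pre post : List (Fin n)}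
    (h : A v = pre ++ w :: post) : nbrAt A ((v : ℕ) : ℤ) (pre.length : ℤ) = some ((w : ℕ) : ℤ) := by
  simp [nbrAt, readAt, h]

/-- The working arrays when the triples `(a, b, s_a(b))`, for the pairs `(a, b)` in `l`, have been
found. -/
noncomputable def tripleHeap (G : SimpleGraph (Fin n)) (l : List (Fin n × Fin n)) :
    List (List ℤ) :=
  [[(l.length : ℤ)], pad (2 * (n - 1)) (l.map fun p => ((p.1 : ℕ) : ℤ)),
    pad (2 * (n - 1)) (l.map fun p => ((p.2 : ℕ) : ℤ)),
    pad (2 * (n - 1)) (l.map fun p => (dirSize G p.1 p.2 : ℤ)), []]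

/-- The body of the loop of `sizesProc`. -/
def sizesLoopBody : List Stmt :=
  [ .assign 4 (.nbr (.var 1) (.var 3)),
    .cond (.ne (.var 4) (.var 0))
      [ .call 5 0 [.var 1, .var 4],
        .assign 2 (.add (.var 2) (.var 5)) ],
    .assign 3 (.add (.var 3) (.lit 1)) ]

/-- The loop of `sizesProc`. -/
def sizesLoop : Stmt := .loop (.lt (.var 3) (.deg (.var 1))) sizesLoopBody

/-- The part of `sizesProc` after its loop. -/
def sizesRecord : List Stmt := sizesProc.body.drop 3

theorem sizesProc_body : sizesProc.body =
    .assign 2 (.lit 1) :: .assign 3 (.lit 0) :: sizesLoop :: sizesRecord := rfl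

variable {G : SimpleGraph (Fin n)} {A : AdjLists n} {M : ℤ}

theorem dirSize_le (G : SimpleGraph (Fin n)) (u v : Fin n) : dirSize G u v ≤ n := by
  simpa [dirSize] using Finset.card_le_univ (branch G u v)

theorem abs_natCast_le {m : ℕ} (hM : 2 * (n : ℤ) ≤ M) (h : m ≤ 2 * n) : |(m : ℤ)| ≤ M := by
  rw [Nat.abs_cast]
  omega

theorem sizesRecord_spec (hG : G.IsTree) (hM : 2 * (n : ℤ) ≤ M) {u v : Fin n} (h : G.Adj u v)
    (l : List (Fin n × Fin n)) (hl : l.length + 2 ≤ 2 * (n - 1)) (i w r k : ℤ) (act : Act)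
    (hact : act.dest < act.loc.length) (st : List Act) :
    Steps computeExpectedPlanar A M 60
      ⟨sizesRecord, [((u : ℕ) : ℤ), ((v : ℕ) : ℤ), (dirSize G u v : ℤ), i, w, r, k], act :: st,
        tripleHeap G l⟩
      ⟨act.code, act.loc.set act.dest (dirSize G u v : ℤ), st,
        tripleHeap G (l ++ [(u, v), (v, u)])⟩ := by
  have hu : |((u : ℕ) : ℤ)| ≤ M := abs_natCast_le hM (by omega)
  have hv : |((v : ℕ) : ℤ)| ≤ M := abs_natCast_le hM (by omega)
  have hs : |(dirSize G u v : ℤ)| ≤ M := abs_natCast_le hM (by have := dirSize_le G u v; omega)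
  have hs' : (n : ℤ) - dirSize G u v = dirSize G v u := by
    have := dirSize_add_dirSize hG h
    rw [Fintype.card_fin] at this
    omega
  have hs'' : |(n : ℤ) - dirSize G u v| ≤ M := by
    rw [hs']
    exact abs_natCast_le hM (by have := dirSize_le G v u; omega)
  have hk0 : |(l.length : ℤ)| ≤ M := abs_natCast_le hM (by omega)
  have hk1 : |(l.length : ℤ) + 1| ≤ M := by
    exact_mod_cast abs_natCast_le (m := l.length + 1) hM (by omega)
  have hk2 : |(l.length : ℤ) + 1 + 1| ≤ M := by
    exact_mod_cast abs_natCast_le (m := l.length + 1 + 1) hM (by omega)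
  have e : tripleHeap G (l ++ [(u, v), (v, u)]) =
      [[(l.length : ℤ) + 1 + 1],
        pad (2 * (n - 1)) (l.map (fun p => ((p.1 : ℕ) : ℤ)) ++ [((u : ℕ) : ℤ)] ++ [((v : ℕ) : ℤ)]),
        pad (2 * (n - 1)) (l.map (fun p => ((p.2 : ℕ) : ℤ)) ++ [((v : ℕ) : ℤ)] ++ [((u : ℕ) : ℤ)]),
        pad (2 * (n - 1)) (l.map (fun p => (dirSize G p.1 p.2 : ℤ)) ++ [(dirSize G u v : ℤ)] ++
          [(n : ℤ) - dirSize G u v]), []] := by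
    simp [tripleHeap, hs', add_assoc]
  rw [e]
  refine Steps.assign (l.length : ℤ) rfl (by simp) hk0 (by decide) ?_
  refine Steps.store (l.length : ℤ) ((u : ℕ) : ℤ) _ _ rfl rfl rfl
    (writeAt_pad (by simp; omega) (by simp) _) hu (by decide) ?_
  refine Steps.store (l.length : ℤ) ((v : ℕ) : ℤ) _ _ rfl rfl rfl
    (writeAt_pad (by simp; omega) (by simp) _) hv (by decide) ?_
  refine Steps.store (l.length : ℤ) (dirSize G u v : ℤ) _ _ rfl rfl rfl
    (writeAt_pad (by simp; omega) (by simp) _) hs (by decide) ?_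
  refine Steps.assign ((l.length : ℤ) + 1) rfl (by simp) hk1 (by decide) ?_
  refine Steps.store ((l.length : ℤ) + 1) ((v : ℕ) : ℤ) _ _ rfl rfl rfl
    (writeAt_pad (by simp; omega) (by simp) _) hv (by decide) ?_
  refine Steps.store ((l.length : ℤ) + 1) ((u : ℕ) : ℤ) _ _ rfl rfl rfl
    (writeAt_pad (by simp; omega) (by simp) _) hu (by decide) ?_
  refine Steps.store ((l.length : ℤ) + 1) ((n : ℤ) - dirSize G u v) _ _ rfl rfl rfl
    (writeAt_pad (by simp; omega) (by simp) _) hs'' (by decide) ?_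
  refine Steps.assign ((l.length : ℤ) + 1 + 1) rfl (by simp) hk2 (by decide) ?_
  refine Steps.store 0 ((l.length : ℤ) + 1 + 1) [(l.length : ℤ)] [(l.length : ℤ) + 1 + 1] rfl rfl
    rfl rfl hk2 (by decide) ?_
  refine Steps.ret (dirSize G u v : ℤ) rfl hact hs (by decide) ?_
  exact (Steps.refl _).mono (Nat.zero_le _)

/-- A value of `f` for both directions of the edge from `x` towards `r`. -/
noncomputable def bothWays (G : SimpleGraph (Fin n)) (f : Fin n → Fin n → ℤ) (r x : Fin n) : ℤ :=
  f x (toward G x r) + f (toward G x r) x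

/-- The list `T` consists of the ordered pairs of adjacent vertices of the subtree of `v` with
respect to the root `u`, the edge `uv` included. -/
def Lists (G : SimpleGraph (Fin n)) (u v : Fin n) (T : List (Fin n × Fin n)) : Prop :=
  ∀ f : Fin n → Fin n → ℤ,
    (T.map fun p => f p.1 p.2).sum = ∑ x ∈ branch G u v, bothWays G f u x

theorem Lists.length_eq {u v : Fin n} {T : List (Fin n × Fin n)} (h : Lists G u v T) :
    T.length = 2 * dirSize G u v := by
  have := h fun _ _ => 1
  simp [bothWays, dirSize] at this ⊢
  omega

/-- What a call of `sizesProc` does. -/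
def SizesSpec (G : SimpleGraph (Fin n)) (A : AdjLists n) (M : ℤ) (u v : Fin n) : Prop :=
  ∀ (l : List (Fin n × Fin n)) (act : Act) (st : List Act),
    l.length + 2 * dirSize G u v ≤ 2 * (n - 1) → act.dest < act.loc.length →
      ∃ T, Lists G u v T ∧
        Steps computeExpectedPlanar A M (220 * dirSize G u v - 40)
          ⟨sizesProc.body, [((u : ℕ) : ℤ), ((v : ℕ) : ℤ), 0, 0, 0, 0, 0], act :: st,
            tripleHeap G l⟩
          ⟨act.code, act.loc.set act.dest (dirSize G u v : ℤ), st, tripleHeap G (l ++ T)⟩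

theorem sizesLoop_spec (hG : G.IsTree) (hA : A.Represents G) (hM : 2 * (n : ℤ) ≤ M) {u v : Fin n}
    (hspec : ∀ w, G.Adj v w → w ≠ u → SizesSpec G A M v w) (st : List Act) (rest : List Stmt)
    (k : ℤ) (post : List (Fin n)) :
    ∀ (pre : List (Fin n)) (l : List (Fin n × Fin n)) (s : ℕ) (w r : ℤ), A v = pre ++ post →
      l.length + 2 * ((post.filter (· ≠ u)).map (dirSize G v)).sum ≤ 2 * (n - 1) →
      s + ((post.filter (· ≠ u)).map (dirSize G v)).sum ≤ n →
      ∃ T w' r', (∀ f : Fin n → Fin n → ℤ, (T.map fun p => f p.1 p.2).sum =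
          ((post.filter (· ≠ u)).map fun w => ∑ x ∈ branch G v w, bothWays G f v x).sum) ∧
        Steps computeExpectedPlanar A M
          (220 * ((post.filter (· ≠ u)).map (dirSize G v)).sum + 40 * post.count u + 40)
          ⟨sizesLoop :: rest,
            [((u : ℕ) : ℤ), ((v : ℕ) : ℤ), (s : ℤ), (pre.length : ℤ), w, r, k], st,
            tripleHeap G l⟩
          ⟨rest, [((u : ℕ) : ℤ), ((v : ℕ) : ℤ),
              ((s + ((post.filter (· ≠ u)).map (dirSize G v)).sum : ℕ) : ℤ),
              ((A v).length : ℤ), w', r', k], st, tripleHeap G (l ++ T)⟩ := by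
  have hlen : ∀ u : Fin n, (A u).length ≤ n := fun u => by
    simpa using (hA u).1.length_le_card
  induction post with
  | nil =>
    intro pre l s w r hpre _ _
    refine ⟨[], w, r, by simp, ?_⟩
    refine Steps.loop_false ?_ (by simp [Test.cost, Exp.cost]) ?_
    · simp [Test.eval, Exp.eval, degAt_coe, hpre]
    · simp only [hpre, List.append_nil, List.filter_nil, List.map_nil, List.sum_nil, add_zero]
      exact (Steps.refl _).mono (Nat.zero_le _)
  | cons x post ih =>
    intro pre l s w r hpre hl hs
    have hx : |((x : ℕ) : ℤ)| ≤ M := abs_natCast_le hM (by omega)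
    have hv : |((v : ℕ) : ℤ)| ≤ M := abs_natCast_le hM (by omega)
    have hadj : G.Adj v x := ((hA v).2 x).1 (by simp [hpre])
    have hprelen : pre.length + 1 ≤ n := by
      have := hlen v
      rw [hpre, List.length_append, List.length_cons] at this
      omega
    have hi : |(pre.length : ℤ) + 1| ≤ M := by
      exact_mod_cast abs_natCast_le (m := pre.length + 1) hM (by omega)
    have hpre' : A v = (pre ++ [x]) ++ post := by simp [hpre]
    have htest : Test.eval A [((u : ℕ) : ℤ), ((v : ℕ) : ℤ), (s : ℤ), (pre.length : ℤ), w, r, k]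
        (tripleHeap G l) (.lt (.var 3) (.deg (.var 1))) = some true := by
      simp [Test.eval, Exp.eval, degAt_coe, hpre]
    have hnbr : ∀ s w r : ℤ,
        Exp.eval A [((u : ℕ) : ℤ), ((v : ℕ) : ℤ), s, (pre.length : ℤ), w, r, k]
        (tripleHeap G l) (.nbr (.var 1) (.var 3)) = some ((x : ℕ) : ℤ) := by
      intro s w r
      simp [Exp.eval, nbrAt_coe hpre]
    have hne : ∀ s r : ℤ, Test.eval A
        [((u : ℕ) : ℤ), ((v : ℕ) : ℤ), s, (pre.length : ℤ), ((x : ℕ) : ℤ), r, k]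
        (tripleHeap G l) (.ne (.var 4) (.var 0)) = some (decide (x ≠ u)) := by
      intro s r
      simp [Test.eval, Exp.eval, Fin.ext_iff]
    by_cases hxu : x = u
    · have e1 : (x :: post).filter (· ≠ u) = post.filter (· ≠ u) := by simp [hxu]
      have e2 : (x :: post).count u = post.count u + 1 := by simp [hxu]
      rw [e1] at hl hs ⊢
      obtain ⟨T, w', r', hT, hsteps⟩ := ih (pre ++ [x]) l s ((x : ℕ) : ℤ) r hpre' hl hs
      refine ⟨T, w', r', hT, ?_⟩
      rw [e2]
      have h1 : Steps computeExpectedPlanar A M 40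
          ⟨sizesLoop :: rest,
            [((u : ℕ) : ℤ), ((v : ℕ) : ℤ), (s : ℤ), (pre.length : ℤ), w, r, k], st,
            tripleHeap G l⟩
          ⟨sizesLoop :: rest,
            [((u : ℕ) : ℤ), ((v : ℕ) : ℤ), (s : ℤ), ((pre ++ [x]).length : ℤ), ((x : ℕ) : ℤ), r,
              k], st, tripleHeap G l⟩ := by
        refine Steps.loop_true htest (by decide) (by decide) ?_
        refine Steps.assign ((x : ℕ) : ℤ) (hnbr _ _ _) (by simp) hx (by decide) ?_
        refine Steps.cond_false ((hne _ _).trans (by simp [hxu])) (by decide) ?_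
        refine Steps.assign ((pre.length : ℤ) + 1) rfl (by simp) hi (by decide) ?_
        rw [List.length_append, List.length_singleton, Nat.cast_add, Nat.cast_one]
        exact (Steps.refl _).mono (Nat.zero_le _)
      exact (h1.trans hsteps).mono (by omega)
    · have e1 : (x :: post).filter (· ≠ u) = x :: post.filter (· ≠ u) := by simp [hxu]
      have e2 : (x :: post).count u = post.count u := by
        rw [List.count_cons_of_ne hxu]
      rw [e1] at hl hs ⊢
      simp only [List.map_cons, List.sum_cons] at hl hs ⊢
      have hpos := dirSize_pos hG hadj
      obtain ⟨T, hT, hcall⟩ := hspec x hadj hxu l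
        ⟨[.assign 2 (.add (.var 2) (.var 5)), .assign 3 (.add (.var 3) (.lit 1)), sizesLoop] ++ rest,
          [((u : ℕ) : ℤ), ((v : ℕ) : ℤ), (s : ℤ), (pre.length : ℤ), ((x : ℕ) : ℤ), r, k], 5⟩ st
        (by omega) (by simp)
      have hTl := hT.length_eq
      obtain ⟨T', w', r', hT', hsteps⟩ := ih (pre ++ [x]) (l ++ T) (s + dirSize G v x)
        ((x : ℕ) : ℤ) (dirSize G v x : ℤ) hpre' (by rw [List.length_append]; omega) (by omega)
      refine ⟨T ++ T', w', r', fun f => ?_, ?_⟩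
      · rw [List.map_append, List.sum_append, hT f, hT' f]
      rw [e2, ← List.append_assoc, ← add_assoc]
      have h1 : Steps computeExpectedPlanar A M 30
          ⟨sizesLoop :: rest,
            [((u : ℕ) : ℤ), ((v : ℕ) : ℤ), (s : ℤ), (pre.length : ℤ), w, r, k], st,
            tripleHeap G l⟩
          ⟨sizesProc.body, [((v : ℕ) : ℤ), ((x : ℕ) : ℤ), 0, 0, 0, 0, 0],
            ⟨[.assign 2 (.add (.var 2) (.var 5)), .assign 3 (.add (.var 3) (.lit 1)),
                sizesLoop] ++ rest,
              [((u : ℕ) : ℤ), ((v : ℕ) : ℤ), (s : ℤ), (pre.length : ℤ), ((x : ℕ) : ℤ), r, k],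
              5⟩ :: st, tripleHeap G l⟩ := by
        refine Steps.loop_true htest (by decide) (by decide) ?_
        refine Steps.assign ((x : ℕ) : ℤ) (hnbr _ _ _) (by simp) hx (by decide) ?_
        refine Steps.cond_true ((hne _ _).trans (by simp [hxu])) (by decide) (by decide) ?_
        refine Steps.call sizesProc [((v : ℕ) : ℤ), ((x : ℕ) : ℤ)] rfl rfl (by simp [sizesProc]) (by decide)
          (by simp only [List.mem_cons, List.not_mem_nil, or_false, forall_eq_or_imp, forall_eq]
              exact ⟨hv, hx⟩) (by omega) (by decide) ?_
        exact (Steps.refl _).mono (Nat.zero_le _)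
      have h2 : Steps computeExpectedPlanar A M 10
          ⟨[.assign 2 (.add (.var 2) (.var 5)), .assign 3 (.add (.var 3) (.lit 1)),
                sizesLoop] ++ rest,
            [((u : ℕ) : ℤ), ((v : ℕ) : ℤ), (s : ℤ), (pre.length : ℤ), ((x : ℕ) : ℤ),
              (dirSize G v x : ℤ), k], st, tripleHeap G (l ++ T)⟩
          ⟨sizesLoop :: rest,
            [((u : ℕ) : ℤ), ((v : ℕ) : ℤ), ((s + dirSize G v x : ℕ) : ℤ),
              ((pre ++ [x]).length : ℤ), ((x : ℕ) : ℤ), (dirSize G v x : ℤ), k], st,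
            tripleHeap G (l ++ T)⟩ := by
        refine Steps.assign ((s : ℤ) + dirSize G v x) rfl (by simp) ?_ (by decide) ?_
        · exact_mod_cast abs_natCast_le (m := s + dirSize G v x) hM (by omega)
        refine Steps.assign ((pre.length : ℤ) + 1) rfl (by simp) hi (by decide) ?_
        rw [List.length_append, List.length_singleton, Nat.cast_add, Nat.cast_add, Nat.cast_one]
        exact (Steps.refl _).mono (Nat.zero_le _)
      exact (h1.trans (hcall.trans (h2.trans hsteps))).mono (by omega)

theorem bothWays_congr (hG : G.IsTree) (f : Fin n → Fin n → ℤ) {u v x : Fin n} (h : G.Adj u v)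
    (hu : x ≠ u) (hv : x ≠ v) : bothWays G f u x = bothWays G f v x := by
  rw [bothWays, bothWays, toward_congr hG h hu.symm hv.symm]

theorem sizes_spec (hG : G.IsTree) (hA : A.Represents G) (hM : 2 * (n : ℤ) ≤ M) {u v : Fin n}
    (h : G.Adj u v) : SizesSpec G A M u v := by
  induction hm : dirSize G u v using Nat.strong_induction_on generalizing u v with
  | _ m ih =>
  subst hm
  have hmem : ∀ w, w ∈ (A v).toFinset ↔ G.Adj v w := fun w => by
    rw [List.mem_toFinset, (hA v).2 w]
  have hfin : ((A v).filter (· ≠ u)).toFinset = (A v).toFinset.erase u := by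
    ext w; simp [and_comm]
  have hnd : ((A v).filter (· ≠ u)).Nodup := (hA v).1.filter _
  have hq : dirSize G u v = 1 + (((A v).filter (· ≠ u)).map (dirSize G v)).sum := by
    rw [dirSize_eq hG h hmem, ← hfin, List.sum_toFinset _ hnd]
  have hc : (A v).count u = 1 :=
    List.count_eq_one_of_mem (hA v).1 (((hA v).2 u).2 h.symm)
  have hspec : ∀ w, G.Adj v w → w ≠ u → SizesSpec G A M v w := by
    intro w hw hwu
    refine ih _ ?_ hw rfl
    rw [hq]
    have : dirSize G v w ≤ (((A v).filter (· ≠ u)).map (dirSize G v)).sum :=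
      List.single_le_sum (by simp) _
        (List.mem_map_of_mem (List.mem_filter.2 ⟨((hA v).2 w).2 hw, by simpa using hwu⟩))
    omega
  intro l act st hl hact
  have hle := dirSize_le G u v
  obtain ⟨T, w', r', hT, hloop⟩ := sizesLoop_spec hG hA hM hspec (act :: st) sizesRecord 0 (A v) []
    l 1 0 0 rfl (by omega) (by omega)
  rw [← hq] at hloop
  have hTs : ∀ f : Fin n → Fin n → ℤ, (T.map fun p => f p.1 p.2).sum =
      ∑ w ∈ (A v).toFinset.erase u, ∑ x ∈ branch G v w, bothWays G f v x := fun f => by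
    rw [hT f, ← hfin, List.sum_toFinset _ hnd]
  have hTlen : T.length + 2 = 2 * dirSize G u v := by
    have h1 := hT fun _ _ => 1
    have h2 : (((A v).filter (· ≠ u)).map fun w => ∑ x ∈ branch G v w,
        bothWays G (fun _ _ => 1) v x).sum =
          2 * ((((A v).filter (· ≠ u)).map (dirSize G v)).sum : ℤ) := by
      rw [← List.sum_toFinset _ hnd, ← List.sum_toFinset _ hnd, Nat.cast_sum, Finset.mul_sum]
      refine Finset.sum_congr rfl fun w _ => ?_
      simp [bothWays, dirSize, mul_comm]
    rw [h2] at h1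
    simp only [List.map_const', List.sum_replicate, nsmul_eq_mul, mul_one] at h1
    omega
  refine ⟨T ++ [(u, v), (v, u)], fun f => ?_, ?_⟩
  · rw [sum_branch hG _ h hmem, List.map_append, List.sum_append, hTs]
    have h1 : ∑ w ∈ (A v).toFinset.erase u, ∑ x ∈ branch G v w, bothWays G f v x =
        ∑ w ∈ (A v).toFinset.erase u, ∑ x ∈ branch G v w, bothWays G f u x := by
      refine Finset.sum_congr rfl fun w hw => Finset.sum_congr rfl fun x hx => ?_
      rw [Finset.mem_erase, hmem] at hw
      rw [mem_branch] at hx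
      rw [bothWays_congr hG f h]
      · rintro rfl
        exact hw.1 (hx.symm.trans (toward_of_adj hG h.symm))
      · rintro rfl
        rw [toward_self hG] at hx
        exact hw.2.ne hx
    rw [h1, bothWays, toward_of_adj hG h.symm]
    simp
    ring
  · have hrec := sizesRecord_spec (A := A) hG hM h (l ++ T) (by rw [List.length_append]; omega)
      ((A v).length : ℤ) w' r' 0 act hact st
    have h0 : Steps computeExpectedPlanar A M 10
        ⟨sizesProc.body, [((u : ℕ) : ℤ), ((v : ℕ) : ℤ), 0, 0, 0, 0, 0], act :: st,
            tripleHeap G l⟩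
        ⟨sizesLoop :: sizesRecord, [((u : ℕ) : ℤ), ((v : ℕ) : ℤ), ((1 : ℕ) : ℤ),
          (([] : List (Fin n)).length : ℤ), 0, 0, 0], act :: st, tripleHeap G l⟩ := by
      have hn : 1 ≤ n := by omega
      rw [sizesProc_body]
      refine Steps.assign 1 rfl (by simp) (by simp; omega) (by decide) ?_
      refine Steps.assign 0 rfl (by simp) (by simp; omega) (by decide) ?_
      exact (Steps.refl _).mono (Nat.zero_le _)
    rw [← List.append_assoc]
    refine (h0.trans (hloop.trans hrec)).mono ?_
    rw [hc]
    omega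

end Sizes

/-! ## The main procedure -/

section Main

variable {n : ℕ} {G : SimpleGraph (Fin n)} {A : AdjLists n} {M : ℤ}

/-- The body of the first loop of `mainProc`. -/
def callLoopBody : List Stmt :=
  [ .assign 1 (.nbr (.lit 0) (.var 0)),
    .call 2 0 [.lit 0, .var 1],
    .assign 0 (.add (.var 0) (.lit 1)) ]

/-- The first loop of `mainProc`. -/
def callLoop : Stmt := .loop (.lt (.var 0) (.deg (.lit 0))) callLoopBody

/-- The body of the second loop of `mainProc`. -/
def squareLoopBody : List Stmt :=
  [ .assign 4 (.get src (.var 3)),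
    .store acc (.var 4)
      (.add (.get acc (.var 4)) (.mul (.get siz (.var 3)) (.get siz (.var 3)))),
    .assign 3 (.add (.var 3) (.lit 1)) ]

/-- The second loop of `mainProc`. -/
def squareLoop : Stmt := .loop (.lt (.var 3) (.get cnt (.lit 0))) squareLoopBody

/-- The body of the third loop of `mainProc`. -/
def degreeLoopBody : List Stmt :=
  [ .assign 5
      (.add (.var 5)
        (.mul (.sub (.mul (.lit 2) (.deg (.var 4))) (.lit 1)) (.get acc (.var 4)))),
    .assign 4 (.add (.var 4) (.lit 1)) ]

/-- The third loop of `mainProc`. -/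
def degreeLoop : Stmt := .loop (.lt (.var 4) .size) degreeLoopBody

/-- The part of `mainProc` after its loops. -/
def resultCode : List Stmt :=
  [ .assign 6
      (.sub
        (.mul (.sub .size (.lit 1))
          (.sub (.add (.mul (.lit 3) (.mul .size .size)) (.mul (.lit 2) .size)) (.lit 2)))
        (.var 5)),
    .assign 7 (.mul (.lit 6) .size) ]

theorem mainProc_body : mainProc.body =
    .alloc cnt (.lit 1) :: .alloc src (.mul (.lit 2) (.sub .size (.lit 1))) ::
      .alloc dst (.mul (.lit 2) (.sub .size (.lit 1))) ::
      .alloc siz (.mul (.lit 2) (.sub .size (.lit 1))) :: .assign 0 (.lit 0) :: callLoop ::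
      .alloc acc .size :: .assign 3 (.lit 0) :: squareLoop :: .assign 4 (.lit 0) ::
      .assign 5 (.lit 0) :: degreeLoop :: resultCode := rfl

theorem callLoop_spec (hG : G.IsTree) (hA : A.Represents G) (hM : 2 * (n : ℤ) ≤ M) {v : Fin n}
    (hv0 : (v : ℕ) = 0) (st : List Act) (rest : List Stmt) (k a b c d : ℤ)
    (post : List (Fin n)) :
    ∀ (pre : List (Fin n)) (l : List (Fin n × Fin n)) (w r : ℤ), A v = pre ++ post →
      l.length + 2 * (post.map (dirSize G v)).sum ≤ 2 * (n - 1) →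
      ∃ T i' w' r', (∀ f : Fin n → Fin n → ℤ, (T.map fun p => f p.1 p.2).sum =
          (post.map fun w => ∑ x ∈ branch G v w, bothWays G f v x).sum) ∧
        Steps computeExpectedPlanar A M (220 * (post.map (dirSize G v)).sum + 40)
          ⟨callLoop :: rest, [(pre.length : ℤ), w, r, k, a, b, c, d], st, tripleHeap G l⟩
          ⟨rest, [i', w', r', k, a, b, c, d], st, tripleHeap G (l ++ T)⟩ := by
  have hlen : (A v).length ≤ n := by simpa using (hA v).1.length_le_card
  have hvz : ((v : ℕ) : ℤ) = 0 := by rw [hv0]; rfl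
  have hdeg : degAt A 0 = some ((A v).length : ℤ) := hvz ▸ degAt_coe A v
  induction post with
  | nil =>
    intro pre l w r hpre _
    refine ⟨[], pre.length, w, r, by simp, ?_⟩
    refine Steps.loop_false ?_ (by simp [Test.cost, Exp.cost]) ?_
    · simp [Test.eval, Exp.eval, hdeg, hpre]
    · rw [List.append_nil]
      exact (Steps.refl _).mono (Nat.zero_le _)
  | cons x post ih =>
    intro pre l w r hpre hl
    simp only [List.map_cons, List.sum_cons] at hl ⊢
    have hx : |((x : ℕ) : ℤ)| ≤ M := abs_natCast_le hM (by omega)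
    have hadj : G.Adj v x := ((hA v).2 x).1 (by simp [hpre])
    have hprelen : pre.length + 1 ≤ n := by
      rw [hpre, List.length_append, List.length_cons] at hlen
      omega
    have hi : |(pre.length : ℤ) + 1| ≤ M := by
      exact_mod_cast abs_natCast_le (m := pre.length + 1) hM (by omega)
    have hM0 : 0 ≤ M := by omega
    have hpos := dirSize_pos hG hadj
    obtain ⟨T, hT, hcall⟩ := sizes_spec hG hA hM hadj l
      ⟨.assign 0 (.add (.var 0) (.lit 1)) :: callLoop :: rest,
        [(pre.length : ℤ), ((x : ℕ) : ℤ), r, k, a, b, c, d], 2⟩ st (by omega) (by simp)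
    have hTl := hT.length_eq
    obtain ⟨T', i', w', r', hT', hsteps⟩ := ih (pre ++ [x]) (l ++ T) ((x : ℕ) : ℤ)
      (dirSize G v x : ℤ) (by simp [hpre]) (by rw [List.length_append]; omega)
    refine ⟨T ++ T', i', w', r', fun f => ?_, ?_⟩
    · rw [List.map_append, List.sum_append, hT f, hT' f]
    have h1 : Steps computeExpectedPlanar A M 30
        ⟨callLoop :: rest, [(pre.length : ℤ), w, r, k, a, b, c, d], st, tripleHeap G l⟩
        ⟨sizesProc.body, [((v : ℕ) : ℤ), ((x : ℕ) : ℤ), 0, 0, 0, 0, 0],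
          ⟨.assign 0 (.add (.var 0) (.lit 1)) :: callLoop :: rest,
            [(pre.length : ℤ), ((x : ℕ) : ℤ), r, k, a, b, c, d], 2⟩ :: st, tripleHeap G l⟩ := by
      rw [hvz]
      refine Steps.loop_true (by simp [Test.eval, Exp.eval, hdeg, hpre]) (by decide) (by decide) ?_
      refine Steps.assign ((x : ℕ) : ℤ) ?_ (by simp) hx (by decide) ?_
      · have := nbrAt_coe hpre
        rw [hvz] at this
        simp [Exp.eval, this]
      refine Steps.call sizesProc [0, ((x : ℕ) : ℤ)] rfl rfl (by simp [sizesProc]) (by decide)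
        ?_ hM0 (by decide) ?_
      · simp only [List.mem_cons, List.not_mem_nil, or_false, forall_eq_or_imp, forall_eq]
        exact ⟨by simpa using hM0, hx⟩
      exact (Steps.refl _).mono (Nat.zero_le _)
    have h2 : Steps computeExpectedPlanar A M 10
        ⟨.assign 0 (.add (.var 0) (.lit 1)) :: callLoop :: rest,
          [(pre.length : ℤ), ((x : ℕ) : ℤ), (dirSize G v x : ℤ), k, a, b, c, d], st,
          tripleHeap G (l ++ T)⟩
        ⟨callLoop :: rest, [((pre ++ [x]).length : ℤ), ((x : ℕ) : ℤ), (dirSize G v x : ℤ),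
          k, a, b, c, d], st, tripleHeap G (l ++ T)⟩ := by
      refine Steps.assign ((pre.length : ℤ) + 1) rfl (by simp) hi (by decide) ?_
      rw [List.length_append, List.length_singleton, Nat.cast_add, Nat.cast_one]
      exact (Steps.refl _).mono (Nat.zero_le _)
    rw [← List.append_assoc]
    exact (h1.trans (hcall.trans (h2.trans hsteps))).mono (by omega)

theorem readAt_ofFn (f : Fin n → ℤ) (v : Fin n) :
    readAt (List.ofFn f) ((v : ℕ) : ℤ) = some (f v) := by
  simp [readAt]

theorem writeAt_ofFn (f : Fin n → ℤ) (v : Fin n) (z : ℤ) :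
    writeAt (List.ofFn f) ((v : ℕ) : ℤ) z = some (List.ofFn (Function.update f v z)) := by
  rw [writeAt, if_pos (by simp)]
  congr 1
  refine List.ext_getElem (by simp) fun i h1 h2 => ?_
  simp only [Int.toNat_natCast, List.getElem_set, List.getElem_ofFn, Function.update_apply,
    Fin.ext_iff, eq_comm]

/-- The sum of the squares of the sizes at `v` in a list of pairs. -/
noncomputable def squares (G : SimpleGraph (Fin n)) (l : List (Fin n × Fin n)) (v : Fin n) : ℤ :=
  (l.map fun p => if p.1 = v then (dirSize G p.1 p.2 : ℤ) ^ 2 else 0).sum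

theorem squares_append (l l' : List (Fin n × Fin n)) (v : Fin n) :
    squares G (l ++ l') v = squares G l v + squares G l' v := by
  simp [squares]

theorem squares_nonneg (l : List (Fin n × Fin n)) (v : Fin n) : 0 ≤ squares G l v := by
  refine List.sum_nonneg fun x hx => ?_
  obtain ⟨p, -, rfl⟩ := List.mem_map.1 hx
  split_ifs
  · positivity
  · exact le_rfl

/-- The working arrays with the array `acc` allocated. -/
noncomputable def fullHeap (G : SimpleGraph (Fin n)) (l : List (Fin n × Fin n))
    (f : Fin n → ℤ) : List (List ℤ) := (tripleHeap G l).set acc (List.ofFn f)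

theorem squareLoop_spec (hM : 2 * (n : ℤ) ≤ M) (l : List (Fin n × Fin n))
    (hl : l.length < 2 * n) (hl' : ∀ v, squares G l v ≤ M) (st : List Act) (rest : List Stmt)
    (i w r a b c : ℤ) (post : List (Fin n × Fin n)) :
    ∀ (pre : List (Fin n × Fin n)) (u : ℤ), l = pre ++ post →
      ∃ u', Steps computeExpectedPlanar A M (40 * post.length + 40)
          ⟨squareLoop :: rest, [i, w, r, (pre.length : ℤ), u, a, b, c], st,
            fullHeap G l (squares G pre)⟩
          ⟨rest, [i, w, r, (l.length : ℤ), u', a, b, c], st, fullHeap G l (squares G l)⟩ := by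
  induction post with
  | nil =>
    intro pre u hpre
    rw [List.append_nil] at hpre
    subst hpre
    refine ⟨u, Steps.loop_false ?_ (by simp [Test.cost, Exp.cost]) ?_⟩
    · simp [Test.eval, Exp.eval, fullHeap, tripleHeap, readAt]
    · exact (Steps.refl _).mono (Nat.zero_le _)
  | cons p post ih =>
    intro pre u hpre
    obtain ⟨u', hsteps⟩ := ih (pre ++ [p]) ((p.1 : ℕ) : ℤ) (by simp [hpre])
    refine ⟨u', ?_⟩
    have hlt : pre.length < l.length := by simp [hpre]
    have hi : |(pre.length : ℤ) + 1| ≤ M := by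
      exact_mod_cast abs_natCast_le (m := pre.length + 1) hM (by omega)
    have hp : |((p.1 : ℕ) : ℤ)| ≤ M := abs_natCast_le hM (by omega)
    have hsq : ∀ v, squares G (pre ++ [p]) v =
        squares G pre v + if p.1 = v then (dirSize G p.1 p.2 : ℤ) ^ 2 else 0 := by
      intro v
      rw [squares_append]
      simp [squares]
    have hupd : Function.update (squares G pre) p.1
        (squares G pre p.1 + (dirSize G p.1 p.2 : ℤ) * dirSize G p.1 p.2) =
          squares G (pre ++ [p]) := by
      funext v
      rw [hsq, Function.update_apply]
      by_cases h : v = p.1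
      · rw [if_pos h, if_pos h.symm, h]; ring
      · rw [if_neg h, if_neg (Ne.symm h), add_zero]
    have hz : |squares G pre p.1 + (dirSize G p.1 p.2 : ℤ) * dirSize G p.1 p.2| ≤ M := by
      have e : squares G pre p.1 + (dirSize G p.1 p.2 : ℤ) * dirSize G p.1 p.2 =
          squares G (pre ++ [p]) p.1 := by rw [hsq, if_pos rfl]; ring
      rw [e, abs_of_nonneg (squares_nonneg _ _)]
      refine le_trans ?_ (hl' p.1)
      rw [hpre, show pre ++ p :: post = (pre ++ [p]) ++ post by simp, squares_append _ post]
      exact le_add_of_nonneg_right (squares_nonneg _ _)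
    have hsrc : readAt (pad (2 * (n - 1)) (l.map fun p => ((p.1 : ℕ) : ℤ))) (pre.length : ℤ) =
        some ((p.1 : ℕ) : ℤ) := by
      rw [readAt_pad (by simpa using hlt)]
      simp [hpre]
    have hsiz : readAt (pad (2 * (n - 1)) (l.map fun p => (dirSize G p.1 p.2 : ℤ)))
        (pre.length : ℤ) = some (dirSize G p.1 p.2 : ℤ) := by
      rw [readAt_pad (by simpa using hlt)]
      simp [hpre]
    have h1 : Steps computeExpectedPlanar A M 40
        ⟨squareLoop :: rest, [i, w, r, (pre.length : ℤ), u, a, b, c], st,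
          fullHeap G l (squares G pre)⟩
        ⟨squareLoop :: rest, [i, w, r, ((pre ++ [p]).length : ℤ), ((p.1 : ℕ) : ℤ), a, b, c], st,
          fullHeap G l (squares G (pre ++ [p]))⟩ := by
      refine Steps.loop_true ?_ (by decide) (by decide) ?_
      · simp [Test.eval, Exp.eval, fullHeap, tripleHeap, readAt, hlt]
      refine Steps.assign ((p.1 : ℕ) : ℤ) ?_ (by simp) hp (by decide) ?_
      · simp [Exp.eval, fullHeap, tripleHeap, hsrc]
      refine Steps.store ((p.1 : ℕ) : ℤ)
        (squares G pre p.1 + (dirSize G p.1 p.2 : ℤ) * dirSize G p.1 p.2)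
        (List.ofFn (squares G pre)) (List.ofFn (squares G (pre ++ [p]))) rfl ?_ rfl
        (by rw [writeAt_ofFn, hupd]) hz (by decide) ?_
      · simp [Exp.eval, fullHeap, tripleHeap, hsiz, readAt_ofFn]
      refine Steps.assign ((pre.length : ℤ) + 1) rfl (by simp) hi (by decide) ?_
      rw [List.length_append, List.length_singleton, Nat.cast_add, Nat.cast_one]
      exact (Steps.refl _).mono (Nat.zero_le _)
    exact (h1.trans hsteps).mono (by rw [List.length_cons]; omega)

/-- The terms of the sum over the vertices, as a function of the number of a vertex. -/
def degreeTerm (A : AdjLists n) (f : Fin n → ℤ) (i : ℕ) : ℤ :=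
  if h : i < n then (2 * ((A ⟨i, h⟩).length : ℤ) - 1) * f ⟨i, h⟩ else 0

theorem degreeLoop_spec (hM : 2 * (n : ℤ) ≤ M) (l : List (Fin n × Fin n)) (f : Fin n → ℤ)
    (hf : ∑ i ∈ Finset.range n, |degreeTerm A f i| ≤ M) (st : List Act) (rest : List Stmt)
    (i w r k b c : ℤ) (m : ℕ) :
    ∀ j : ℕ, j + m = n → Steps computeExpectedPlanar A M (40 * m + 40)
      ⟨degreeLoop :: rest,
        [i, w, r, k, (j : ℤ), ∑ i ∈ Finset.range j, degreeTerm A f i, b, c], st, fullHeap G l f⟩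
      ⟨rest, [i, w, r, k, (n : ℤ), ∑ i ∈ Finset.range n, degreeTerm A f i, b, c], st,
        fullHeap G l f⟩ := by
  induction m with
  | zero =>
    intro j hj
    obtain rfl : j = n := by omega
    refine Steps.loop_false ?_ (by simp [Test.cost, Exp.cost]) ?_
    · simp [Test.eval, Exp.eval]
    · exact (Steps.refl _).mono (Nat.zero_le _)
  | succ m ih =>
    intro j hj
    have hjn : j < n := by omega
    have hi : |(j : ℤ) + 1| ≤ M := by
      exact_mod_cast abs_natCast_le (m := j + 1) hM (by omega)
    have hterm : degreeTerm A f j = (2 * ((A ⟨j, hjn⟩).length : ℤ) - 1) * f ⟨j, hjn⟩ := by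
      rw [degreeTerm, dif_pos hjn]
    have hz : |∑ i ∈ Finset.range j, degreeTerm A f i + degreeTerm A f j| ≤ M := by
      rw [← Finset.sum_range_succ]
      refine (Finset.abs_sum_le_sum_abs _ _).trans (le_trans ?_ hf)
      exact Finset.sum_le_sum_of_subset_of_nonneg
        (Finset.range_subset_range.2 (by omega)) fun _ _ _ => abs_nonneg _
    have hdeg := degAt_coe A ⟨j, hjn⟩
    have hacc := readAt_ofFn f ⟨j, hjn⟩
    have h1 : Steps computeExpectedPlanar A M 40
        ⟨degreeLoop :: rest,
          [i, w, r, k, (j : ℤ), ∑ i ∈ Finset.range j, degreeTerm A f i, b, c], st,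
          fullHeap G l f⟩
        ⟨degreeLoop :: rest,
          [i, w, r, k, ((j + 1 : ℕ) : ℤ), ∑ i ∈ Finset.range (j + 1), degreeTerm A f i, b, c], st,
          fullHeap G l f⟩ := by
      refine Steps.loop_true ?_ (by decide) (by decide) ?_
      · simp [Test.eval, Exp.eval, hjn]
      refine Steps.assign (∑ i ∈ Finset.range j, degreeTerm A f i + degreeTerm A f j) ?_ (by simp)
        hz (by decide) ?_
      · simp only [] at hdeg hacc
        simp [Exp.eval, fullHeap, tripleHeap, hdeg, hacc, hterm]
      refine Steps.assign ((j : ℤ) + 1) rfl (by simp) hi (by decide) ?_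
      rw [Finset.sum_range_succ, Nat.cast_add, Nat.cast_one]
      exact (Steps.refl _).mono (Nat.zero_le _)
    exact (h1.trans (ih (j + 1) (by omega))).mono (by omega)

end Main

section Correctness

variable {n : ℕ} {G : SimpleGraph (Fin n)} {A : AdjLists n}

theorem AdjLists.Represents.toFinset_eq (hA : A.Represents G) (v : Fin n) :
    (A v).toFinset = nbrs G v := by
  ext w
  rw [List.mem_toFinset, (hA v).2, mem_nbrs]

theorem AdjLists.Represents.length_eq (hA : A.Represents G) (v : Fin n) :
    (A v).length = (nbrs G v).card := by
  rw [← hA.toFinset_eq, List.toFinset_card_of_nodup (hA v).1]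

theorem sumSq_le (hG : G.IsTree) (u : Fin n) : sumSq G u ≤ (n : ℤ) ^ 2 := by
  have hn : 1 ≤ n := by have := u.2; omega
  have h1 := sum_dirSize hG u (N := nbrs G u) fun w => mem_nbrs
  rw [Fintype.card_fin] at h1
  have h2 : sumSq G u ≤ ∑ w ∈ nbrs G u, (n : ℤ) * dirSize G u w := by
    refine Finset.sum_le_sum fun w _ => ?_
    rw [sq]
    exact mul_le_mul_of_nonneg_right (by exact_mod_cast dirSize_le G u w) (by positivity)
  rw [← Finset.mul_sum, ← Nat.cast_sum, h1, Nat.cast_sub hn] at h2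
  nlinarith

theorem sum_abs_degreeTerm_le (hG : G.IsTree) (hA : A.Represents G) (r : Fin n)
    (f : Fin n → ℤ) (hf : ∀ v, |f v| ≤ (n : ℤ) ^ 2) :
    ∑ i ∈ Finset.range n, |degreeTerm A f i| ≤ 5 * (n : ℤ) ^ 3 := by
  have h1 : ∑ i ∈ Finset.range n, |degreeTerm A f i| ≤
      ∑ v : Fin n, (2 * ((nbrs G v).card : ℤ) + 1) * (n : ℤ) ^ 2 := by
    rw [Finset.sum_range]
    refine Finset.sum_le_sum fun v _ => ?_
    rw [degreeTerm, dif_pos v.2, Fin.eta, abs_mul, hA.length_eq]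
    refine mul_le_mul ?_ (hf v) (abs_nonneg _) (by positivity)
    rw [abs_le]
    constructor <;> omega
  rw [← Finset.sum_mul, Finset.sum_add_distrib, ← Finset.mul_sum, sum_card_nbrs hG r] at h1
  simp only [Finset.sum_const, Finset.card_univ, Fintype.card_fin, nsmul_eq_mul, mul_one] at h1
  refine h1.trans ?_
  rw [show 5 * (n : ℤ) ^ 3 = 5 * n * (n : ℤ) ^ 2 by ring]
  exact mul_le_mul_of_nonneg_right (by linarith) (sq_nonneg _)

/-- The run of the main procedure. -/
theorem mainProc_spec (hG : G.IsTree) (hA : A.Represents G) {v : Fin n} (hv0 : (v : ℕ) = 0)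
    {M : ℤ} (hM : 10 * (n : ℤ) ^ 3 ≤ M) :
    ∃ c : Config, computeExpectedPlanar.Returns c
        ((n - 1) * (3 * n ^ 2 + 2 * n - 2) - ∑ u, (2 * ((nbrs G u).card : ℤ) - 1) * sumSq G u)
        (6 * n) ∧
      c.clock ≤ 1000 * n ∧
      Relation.ReflTransGen (GoodStep computeExpectedPlanar A M) computeExpectedPlanar.init c := by
  have hn : 1 ≤ n := by have := v.2; omega
  have hnz : (1 : ℤ) ≤ n := by exact_mod_cast hn
  have hn2 : (n : ℤ) ≤ (n : ℤ) ^ 2 := by nlinarith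
  have hn3 : (n : ℤ) ^ 2 ≤ (n : ℤ) ^ 3 := by nlinarith
  have hM2 : 2 * (n : ℤ) ≤ M := by linarith
  have hM0 : 0 ≤ M := by linarith
  have hcast : (((2 * (n - 1) : ℕ)) : ℤ) = 2 * ((n : ℤ) - 1) := by
    push_cast [Nat.cast_sub hn]
    ring
  have hsum : ((A v).map (dirSize G v)).sum = n - 1 := by
    rw [← List.sum_toFinset _ (hA v).1, hA.toFinset_eq, sum_dirSize hG v fun w => mem_nbrs,
      Fintype.card_fin]
  obtain ⟨T, i', w', r', hT, hcalls⟩ := callLoop_spec hG hA hM2 hv0 []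
    (.alloc acc .size :: .assign 3 (.lit 0) :: squareLoop :: .assign 4 (.lit 0) ::
      .assign 5 (.lit 0) :: degreeLoop :: resultCode) 0 0 0 0 0 (A v) [] [] 0 0 rfl
    (by rw [hsum]; simp)
  rw [hsum, List.nil_append] at hcalls
  have hT' : ∀ f : Fin n → Fin n → ℤ, (T.map fun p => f p.1 p.2).sum =
      ∑ u, ∑ w ∈ nbrs G u, f u w := fun f => by
    rw [hT, ← List.sum_toFinset _ (hA v).1, hA.toFinset_eq, sum_branches hG _ v fun w => mem_nbrs,
      sum_nbrs_eq hG v]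
    rfl
  have hTlen : T.length = 2 * (n - 1) := by
    have := hT' fun _ _ => 1
    simp only [List.map_const', List.sum_replicate, nsmul_eq_mul, mul_one, Finset.sum_const] at this
    rw [sum_card_nbrs hG v, ← hcast] at this
    exact_mod_cast this
  have hsq : squares G T = sumSq G := by
    funext u
    rw [squares, hT' fun a b => if a = u then (dirSize G a b : ℤ) ^ 2 else 0,
      Finset.sum_eq_single_of_mem u (Finset.mem_univ _)]
    · simp [sumSq]
    · intro b _ hb
      simp [hb]
  obtain ⟨u', hsquares⟩ := squareLoop_spec (A := A) (G := G) hM2 T (by omega)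
    (fun u => by rw [hsq]; linarith [sumSq_le hG u]) []
    (.assign 4 (.lit 0) :: .assign 5 (.lit 0) :: degreeLoop :: resultCode) i' w' r' 0 0 0 T [] 0 rfl
  rw [hsq, hTlen] at hsquares
  have hterms := sum_abs_degreeTerm_le hG hA v (sumSq G) fun u => by
    rw [abs_of_nonneg (Finset.sum_nonneg fun w _ => sq_nonneg _)]
    exact sumSq_le hG u
  have hdegrees := degreeLoop_spec (A := A) (G := G) hM2 T (sumSq G) (hterms.trans (by linarith)) []
    resultCode i' w' r' ((2 * (n - 1) : ℕ) : ℤ) 0 0 n 0 (by omega)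
  set t : ℤ := ∑ i ∈ Finset.range n, degreeTerm A (sumSq G) i with ht
  have htabs : |t| ≤ 5 * (n : ℤ) ^ 3 := (Finset.abs_sum_le_sum_abs _ _).trans hterms
  have ht' : t = ∑ u, (2 * ((nbrs G u).card : ℤ) - 1) * sumSq G u := by
    rw [ht, Finset.sum_range]
    refine Finset.sum_congr rfl fun u _ => ?_
    rw [degreeTerm, dif_pos u.2, Fin.eta, hA.length_eq]
  have hsize : Exp.eval A (List.replicate 8 0) [] (.mul (.lit 2) (.sub .size (.lit 1))) =
      some ((2 * (n - 1) : ℕ) : ℤ) := by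
    rw [hcast]
    rfl
  have s1 : Steps computeExpectedPlanar A M (40 + 6 * (n - 1))
      ⟨mainProc.body, List.replicate 8 0, [], List.replicate 5 []⟩
      ⟨callLoop :: .alloc acc .size :: .assign 3 (.lit 0) :: squareLoop :: .assign 4 (.lit 0) ::
        .assign 5 (.lit 0) :: degreeLoop :: resultCode,
        [(([] : List (Fin n)).length : ℤ), 0, 0, 0, 0, 0, 0, 0], [], tripleHeap G []⟩ := by
    rw [mainProc_body]
    have e : tripleHeap G [] = [[0], List.replicate (2 * (n - 1)) 0,
        List.replicate (2 * (n - 1)) 0, List.replicate (2 * (n - 1)) 0, []] := by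
      simp [tripleHeap, pad]
    rw [e]
    refine Steps.alloc 1 rfl (by simp) hM0 (by simp only [Exp.cost]; omega) ?_
    refine Steps.alloc (2 * (n - 1)) hsize (by simp) hM0 (by simp only [Exp.cost]; omega) ?_
    refine Steps.alloc (2 * (n - 1)) hsize (by simp [dst]) hM0 (by simp only [Exp.cost]; omega) ?_
    refine Steps.alloc (2 * (n - 1)) hsize (by simp [siz]) hM0 (by simp only [Exp.cost]; omega) ?_
    refine Steps.assign 0 rfl (by simp) (by simpa using hM0) (by simp only [Exp.cost]; omega) ?_
    exact (Steps.refl _).mono (Nat.zero_le _)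
  have s2 : Steps computeExpectedPlanar A M (10 + n)
      ⟨.alloc acc .size :: .assign 3 (.lit 0) :: squareLoop :: .assign 4 (.lit 0) ::
        .assign 5 (.lit 0) :: degreeLoop :: resultCode, [i', w', r', 0, 0, 0, 0, 0], [],
        tripleHeap G T⟩
      ⟨squareLoop :: .assign 4 (.lit 0) :: .assign 5 (.lit 0) :: degreeLoop :: resultCode,
        [i', w', r', (([] : List (Fin n × Fin n)).length : ℤ), 0, 0, 0, 0], [],
        fullHeap G T (squares G [])⟩ := by
    have e : fullHeap G T (squares G []) = (tripleHeap G T).set acc (List.replicate n 0) := by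
      rw [fullHeap]
      congr 1
      exact List.ext_getElem (by simp) fun i _ _ => by simp [squares]
    rw [e]
    refine Steps.alloc n rfl (by simp [tripleHeap]) hM0 (by simp only [Exp.cost]; omega) ?_
    refine Steps.assign 0 rfl (by simp) (by simpa using hM0) (by simp only [Exp.cost]; omega) ?_
    exact (Steps.refl _).mono (Nat.zero_le _)
  have s3 : Steps computeExpectedPlanar A M 10
      ⟨.assign 4 (.lit 0) :: .assign 5 (.lit 0) :: degreeLoop :: resultCode,
        [i', w', r', ((2 * (n - 1) : ℕ) : ℤ), u', 0, 0, 0], [], fullHeap G T (sumSq G)⟩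
      ⟨degreeLoop :: resultCode, [i', w', r', ((2 * (n - 1) : ℕ) : ℤ), ((0 : ℕ) : ℤ),
        ∑ i ∈ Finset.range 0, degreeTerm A (sumSq G) i, 0, 0], [], fullHeap G T (sumSq G)⟩ := by
    rw [Finset.sum_range_zero]
    refine Steps.assign 0 rfl (by simp) (by simpa using hM0) (by decide) ?_
    refine Steps.assign 0 rfl (by simp) (by simpa using hM0) (by decide) ?_
    exact (Steps.refl _).mono (Nat.zero_le _)
  have s4 : Steps computeExpectedPlanar A M 40
      ⟨resultCode, [i', w', r', ((2 * (n - 1) : ℕ) : ℤ), (n : ℤ), t, 0, 0], [],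
        fullHeap G T (sumSq G)⟩
      ⟨[], [i', w', r', ((2 * (n - 1) : ℕ) : ℤ), (n : ℤ), t,
        ((n : ℤ) - 1) * (3 * (n * n) + 2 * n - 2) - t, 6 * n], [], fullHeap G T (sumSq G)⟩ := by
    refine Steps.assign (((n : ℤ) - 1) * (3 * (n * n) + 2 * n - 2) - t) rfl (by simp) ?_
      (by decide) ?_
    · have h1 : 0 ≤ ((n : ℤ) - 1) * (3 * (n * n) + 2 * n - 2) :=
        mul_nonneg (by linarith) (by nlinarith)
      have h2 : ((n : ℤ) - 1) * (3 * (n * n) + 2 * n - 2) ≤ 5 * (n : ℤ) ^ 3 := by nlinarith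
      rw [abs_le] at htabs ⊢
      constructor <;> linarith
    refine Steps.assign (6 * (n : ℤ)) rfl (by simp) ?_ (by decide) ?_
    · rw [abs_of_nonneg (by positivity)]
      linarith
    exact (Steps.refl _).mono (Nat.zero_le _)
  have total := s1.trans (hcalls.trans (s2.trans (hsquares.trans (s3.trans (hdegrees.trans s4)))))
  obtain ⟨t', ht'', hreach⟩ := total 0
  refine ⟨_, ⟨rfl, rfl, ?_, rfl⟩, ?_, hreach⟩
  · rw [← ht']
    refine congrArg some ?_
    ring
  · simp only [State.at]
    omega

end Correctness

end PlanarSum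

open PlanarSum in
theorem mainTheorem5 :
    ∃ C : ℕ, ∀ (n : ℕ) (G : SimpleGraph (Fin n)), G.IsTree →
      ∀ A : PlanarSum.AdjLists n, A.Represents G →
        ∃ (k : ℕ) (c : PlanarSum.Config) (p q : ℤ),
          PlanarSum.computeExpectedPlanar.run A k = some c ∧
          PlanarSum.computeExpectedPlanar.Returns c p q ∧
          q ≠ 0 ∧ PlanarSum.expectedPlanar G = (p : ℚ) / (q : ℚ) ∧
          c.clock ≤ C * n ∧
          ∀ j ≤ k, ∃ d : PlanarSum.Config,
            PlanarSum.computeExpectedPlanar.run A j = some d ∧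
            d.space A ≤ C * n ∧
            ∀ w ∈ d.words, |w| ≤ (C : ℤ) * (n : ℤ) ^ 3 := by
  refine ⟨30000, fun n G hG A hA => ?_⟩
  obtain ⟨v⟩ := hG.1.nonempty
  have hn : 0 < n := by have := v.2; omega
  have hn3 : 0 ≤ (n : ℤ) ^ 3 := by positivity
  obtain ⟨c, hret, hclock, hreach⟩ := mainProc_spec (M := ((30000 : ℕ) : ℤ) * (n : ℤ) ^ 3) hG hA
    (v := ⟨0, hn⟩) rfl (by push_cast; linarith)
  obtain ⟨k, hk, hj⟩ := exists_run (by push_cast; linarith) hreach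
  have hsize : computeExpectedPlanar.init.space A ≤ 30 * n := by
    have h1 : ∑ u, (A u).length = 2 * (n - 1) := by
      have := sum_card_nbrs hG v
      simp only [← hA.length_eq] at this
      zify [Nat.one_le_iff_ne_zero.2 hn.ne']
      exact this
    simp [Config.space, Config.words, AdjLists.size, Program.init, h1, computeExpectedPlanar,
      mainProc]
    omega
  refine ⟨k, c, _, _, hk, hret, by omega, expectedPlanar_eq hG v, by omega, fun j hjk => ?_⟩
  obtain ⟨d, hd, hb, -, hs⟩ := hj j hjk
  exact ⟨d, hd, by omega, hb⟩
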